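/- Let $A$ and $B$ be finite sets with $|A| \ge |B| \ge 2$, and let $\mathcal L=\{\exists,\forall,\wedge,\vee\}$. Let $(A;=_A)$ and $(B;=_B)$ be the structures in the signature with one binary relation symbol, interpreted as equality on $A$ and on $B$, respectively. An $\mathcal L$-sentence is a first-order sentence built from atomic formulas $R(x,y)$, where $R$ is the relation symbol and $x,y$ are variables, using only $\exists,\forall,\wedge,\vee$. Then every $\mathcal L$-sentence that is true in $(A;=_A)$ is also true in $(B;=_B)$, that is, this pair of structures is an $\mathcal L$-PMC template, and the promise model checking problem $\mathcal L\text{-}\mathrm{PMC}((A;=_A),(B;=_B))$ is $\mathrm{PSPACE}$-hard. Here the input of the problem is an $\mathcal L$-sentence $\phi$; it is a Yes-instance if $(A;=_A)\vDash\phi$ and a No-instance if $(B;=_B)\not\vDash\phi$. $\mathrm{PSPACE}$-hardness means that for every language $L$ in $\mathrm{PSPACE}$ over a finite alphabet there is a function $f$, computable in logarithmic space, such that $f(w)$ is a Yes-instance for each word $w\in L$ and $f(w)$ is a No-instance for each word $w\notin L$. -/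

import Mathlib

namespace PromiseMC

/-! ### Machines and space complexity -/

/-- Moves of a tape head. -/
inductive Move
  | left
  | stay
  | right

/-- Moving a head on a one-way infinite tape with cells `0, 1, 2, …`; a left move on cell `0` has no
effect. -/
def Move.apply : Move → ℕ → ℕ
  | .left, p => p - 1
  | .stay, p => p
  | .right, p => p + 1

/-- A deterministic single-tape Turing machine with input alphabet `α`. The tape is one-way infinite.
The machine halts when `δ` is undefined (`none`), and accepts iff it then is in a state
from `accept`. -/
structure TM (α : Type) where
  Q : Type
  Γ : Type
  finQ : Finite Q
  finΓ : Finite Γ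
  blank : Γ
  inp : α ↪ Γ
  inp_ne_blank : ∀ a, inp a ≠ blank
  start : Q
  accept : Set Q
  δ : Q → Γ → Option (Q × Γ × Move)

namespace TM

variable {α : Type} (M : TM α)

structure Cfg where
  state : M.Q
  head : ℕ
  tape : ℕ → M.Γ

/-- The input word stands on the leftmost cells, all other cells are blank, and the head is on
cell `0`. -/
def init (w : List α) : M.Cfg where
  state := M.start
  head := 0
  tape := fun i => (w[i]?).elim M.blank M.inp

/-- One step; `none` means that the machine has halted. -/
def step (c : M.Cfg) : Option M.Cfg :=
  (M.δ c.state (c.tape c.head)).map fun r =>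
    { state := r.1
      head := r.2.2.apply c.head
      tape := Function.update c.tape c.head r.2.1 }

/-- `M` halts on every input and accepts exactly the words of `L`. -/
def Decides (L : _root_.Language α) : Prop :=
  ∀ w : List α, ∃ c : M.Cfg,
    StateTransition.Reaches M.step (M.init w) c ∧ M.step c = none ∧ (c.state ∈ M.accept ↔ w ∈ L)

/-- On every input of length `n`, only cells among the first `s n` ones are ever scanned. -/
def RunsInSpace (s : ℕ → ℕ) : Prop :=
  ∀ (w : List α) (c : M.Cfg),
    StateTransition.Reaches M.step (M.init w) c → c.head < s w.length

end TM

/-- The class PSPACE: decidable by a deterministic Turing machine in polynomial space. -/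
def InPSPACE {α : Type} (L : _root_.Language α) : Prop :=
  ∃ (M : TM α) (p : Polynomial ℕ), M.Decides L ∧ M.RunsInSpace fun n => p.eval n

/-- What a read-only input tape shows: an input letter or one of the two end markers. -/
inductive InSym (α : Type)
  | leftEnd
  | letter (a : α)
  | rightEnd

/-- A deterministic Turing transducer with a two-way read-only input tape, `k` read-write work tapes
(one-way infinite), and a write-only output tape. In one step it reads the scanned input symbol and
the scanned symbols of the work tapes, and either halts (`none`) or changes its state, moves the input
head, writes on and moves on every work tape, and writes at most one letter to the output. -/
structure Transducer (α β : Type) where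
  k : ℕ
  Q : Type
  Γ : Type
  finQ : Finite Q
  finΓ : Finite Γ
  blank : Γ
  start : Q
  δ : Q → InSym α → (Fin k → Γ) → Option (Q × Move × (Fin k → Γ × Move) × Option β)

namespace Transducer

variable {α β : Type} (M : Transducer α β)

structure Cfg where
  state : M.Q
  inHead : ℕ
  heads : Fin M.k → ℕ
  tapes : Fin M.k → ℕ → M.Γ
  out : List β

/-- The input tape holds the left end marker on cell `0`, the word `w` on the cells `1, …, |w|` and the
right end marker on cell `|w| + 1`. -/
def readInput (w : List α) : ℕ → InSym α
  | 0 => .leftEnd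
  | i + 1 => (w[i]?).elim .rightEnd .letter

def init : M.Cfg where
  state := M.start
  inHead := 0
  heads := fun _ => 0
  tapes := fun _ _ => M.blank
  out := []

/-- One step on input `w`; `none` means that the machine has halted. The input head never leaves the
cells `0, …, |w| + 1`. -/
def step (w : List α) (c : M.Cfg) : Option M.Cfg :=
  (M.δ c.state (readInput w c.inHead) fun i => c.tapes i (c.heads i)).map fun r =>
    { state := r.1
      inHead := min (r.2.1.apply c.inHead) (w.length + 1)
      heads := fun i => (r.2.2.1 i).2.apply (c.heads i)
      tapes := fun i => Function.update (c.tapes i) (c.heads i) (r.2.2.1 i).1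
      out := c.out ++ r.2.2.2.toList }

/-- On every input `w`, the transducer halts with output `f w`. -/
def Computes (f : List α → List β) : Prop :=
  ∀ w : List α, ∃ c : M.Cfg,
    StateTransition.Reaches (M.step w) M.init c ∧ M.step w c = none ∧ c.out = f w

/-- On every input of length `n`, only cells among the first `s n` ones of each work tape are ever
scanned. -/
def RunsInSpace (s : ℕ → ℕ) : Prop :=
  ∀ (w : List α) (c : M.Cfg),
    StateTransition.Reaches (M.step w) M.init c → ∀ i, c.heads i < s w.length

end Transducer

/-- `f` is computable in logarithmic space. -/
def LogspaceComputable {α β : Type} (f : List α → List β) : Prop :=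
  ∃ (M : Transducer α β) (C : ℕ),
    M.Computes f ∧ M.RunsInSpace fun n => C * (Nat.log 2 n + 1)

/-- A promise problem over the alphabet `β`, given by its Yes-instances and its No-instances. -/
structure PromiseProblem (β : Type) where
  yes : Set (List β)
  no : Set (List β)

/-- Every language in PSPACE reduces to `P` by a logarithmic space many-one reduction, which maps
members to Yes-instances and non-members to No-instances. -/
def PromiseProblem.PSPACEHard {β : Type} (P : PromiseProblem β) : Prop :=
  ∀ (α : Type) [Finite α] (L : _root_.Language α), InPSPACE L →
    ∃ f : List α → List β, LogspaceComputable f ∧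
      ∀ w : List α, (w ∈ L → f w ∈ P.yes) ∧ (w ∉ L → f w ∈ P.no)

/-! ### The `{∃,∀,∧,∨}`-fragment of first-order logic -/

/-- `{∃,∀,∧,∨}`-formulas in the relation symbols of `σ`, with variables `x₀, x₁, x₂, …`. There is no
logical equality symbol: all atomic formulas are `R(x_{v 0}, …, x_{v (n-1)})`. -/
inductive Formula (σ : FirstOrder.Language.{0, 0}) : Type
  | rel {n : ℕ} (R : σ.Relations n) (v : Fin n → ℕ) : Formula σ
  | and (φ ψ : Formula σ) : Formula σ
  | or (φ ψ : Formula σ) : Formula σ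
  | ex (x : ℕ) (φ : Formula σ) : Formula σ
  | all (x : ℕ) (φ : Formula σ) : Formula σ

/-- The letters used to write formulas. -/
inductive Letter (σ : FirstOrder.Language.{0, 0}) : Type
  | rel {n : ℕ} (R : σ.Relations n) : Letter σ
  | and : Letter σ
  | or : Letter σ
  | ex : Letter σ
  | all : Letter σ
  | stroke : Letter σ
  | var : Letter σ

/-- The variable `xᵢ` is written as `i` strokes followed by the letter `var`. -/
def encodeVar {σ : FirstOrder.Language.{0, 0}} (i : ℕ) : List (Letter σ) :=
  List.replicate i Letter.stroke ++ [Letter.var]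

namespace Formula

variable {σ : FirstOrder.Language.{0, 0}}

/-- Formulas as words, in prefix notation. -/
def encode : Formula σ → List (Letter σ)
  | rel R v => Letter.rel R :: (List.ofFn fun i => encodeVar (v i)).flatten
  | and φ ψ => Letter.and :: (encode φ ++ encode ψ)
  | or φ ψ => Letter.or :: (encode φ ++ encode ψ)
  | ex x φ => Letter.ex :: (encodeVar x ++ encode φ)
  | all x φ => Letter.all :: (encodeVar x ++ encode φ)

def freeVars : Formula σ → Set ℕ
  | rel _ v => Set.range v
  | and φ ψ => freeVars φ ∪ freeVars ψ
  | or φ ψ => freeVars φ ∪ freeVars ψ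
  | ex x φ => freeVars φ \ {x}
  | all x φ => freeVars φ \ {x}

def IsSentence (φ : Formula σ) : Prop := φ.freeVars = ∅

/-- Satisfaction under an evaluation `ε` of the variables. -/
def Holds {A : Type*} [σ.Structure A] : Formula σ → (ℕ → A) → Prop
  | rel R v, ε => FirstOrder.Language.Structure.RelMap R fun i => ε (v i)
  | and φ ψ, ε => Holds φ ε ∧ Holds ψ ε
  | or φ ψ, ε => Holds φ ε ∨ Holds ψ ε
  | ex x φ, ε => ∃ a : A, Holds φ (Function.update ε x a)
  | all x φ, ε => ∀ a : A, Holds φ (Function.update ε x a)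

/-- Truth in `A`; used for sentences, whose satisfaction does not depend on the evaluation. -/
def TrueIn (A : Type*) [σ.Structure A] (φ : Formula σ) : Prop :=
  ∀ ε : ℕ → A, φ.Holds ε

end Formula

/-! ### Promise model checking -/

/-- Every sentence that is true in `A` is true in `B`. -/
def IsTemplate (σ : FirstOrder.Language.{0, 0}) (A B : Type*) [σ.Structure A] [σ.Structure B] : Prop :=
  ∀ φ : Formula σ, φ.IsSentence → φ.TrueIn A → φ.TrueIn B

/-- The promise model checking problem: given a sentence, answer Yes if it is true in `A`
and No if it is not true in `B`. -/
def PMC (σ : FirstOrder.Language.{0, 0}) (A B : Type*) [σ.Structure A] [σ.Structure B] :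
    PromiseProblem (Letter σ) where
  yes := {w | ∃ φ : Formula σ, φ.IsSentence ∧ φ.TrueIn A ∧ φ.encode = w}
  no := {w | ∃ φ : Formula σ, φ.IsSentence ∧ ¬ φ.TrueIn B ∧ φ.encode = w}

/-- A single relation symbol, which is binary. -/
inductive EqRel : ℕ → Type
  | eq : EqRel 2

/-- The signature with a single binary relation symbol. -/
def eqLang : FirstOrder.Language.{0, 0} where
  Functions := fun _ => Empty
  Relations := EqRel

/-- The structure `(A; =_A)`. -/
instance eqStructure (A : Type*) : eqLang.Structure A where
  funMap := fun f => nomatch f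
  RelMap := fun {_} R => match R with
    | EqRel.eq => fun v => v 0 = v 1

end PromiseMC

/-!
A surjection preserves positive formulas, so sentences go over from `A` to the smaller set `B`.

For hardness, a machine in polynomial space is turned into a cellular automaton on `S` cells, which
has to be followed for `2 ^ (2 * S)` steps. As in Savitch's theorem, the run is checked by halving:
in each round the existential player gives the array in the middle, and the universal player
decides which half is checked. In equality structures of different sizes, the difficulty is that
the choice of the universal player is an element and not a bit. The sentence begins with a
universal choice of two elements `a` and `b`, which encode the bits, and an existential choice of
`|A|` named elements. For each set of names one game is played, all games in parallel: when the
universal player chooses an element, it has to be one of the named elements, and each game goes on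
with the second half if its set contains the name and with the first half if not. In `A` the names
can exhaust all elements, so the existential player can answer each challenge, and truthful arrays
win all games. In any `B` with two distinct elements `a` and `b`, the challenges `a` and `b` force
both halves of the game whose set consists of the names of `b`. So the arrays of this game are
those of the true run.
-/

namespace PromiseMC

/-! ### Transducers assembled from fragments -/

instance finite_inSym {α : Type} [Finite α] : Finite (InSym α) :=
  Finite.of_surjective
    (fun o : Option (Option α) => match o with
      | none => InSym.leftEnd
      | some none => InSym.rightEnd
      | some (some a) => InSym.letter a)
    (by
      rintro (_ | a | _)
      exacts [⟨none, rfl⟩, ⟨some (some a), rfl⟩, ⟨some none, rfl⟩])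

theorem readInput_of_length_lt {α : Type} {w : List α} {i : ℕ} (h : w.length < i) :
    Transducer.readInput w i = .rightEnd := by
  obtain ⟨j, rfl⟩ := Nat.exists_eq_succ_of_ne_zero (Nat.ne_zero_of_lt h)
  simp only [Transducer.readInput, List.getElem?_eq_none (Nat.le_of_lt_succ h), Option.elim_none]

theorem readInput_min {α : Type} (w : List α) (i : ℕ) :
    Transducer.readInput w (min i (w.length + 1)) = Transducer.readInput w i := by
  rcases le_total i (w.length + 1) with h | h
  · rw [min_eq_left h]
  · rw [min_eq_right h, readInput_of_length_lt h, readInput_of_length_lt (Nat.lt_succ_self _)]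

/-- The symbols on the work tape of a fragment: `none` is the blank, `some none` marks the left end
of the tape, and `some (some x)` is a column with one binary digit of each of the counters `κ`. -/
abbrev TapeSym (κ : Type) := Option (Option (κ → Bool))

/-- A configuration of a fragment without its state. -/
structure Memory (β κ : Type) where
  inHead : ℕ
  head : ℕ
  tape : ℕ → TapeSym κ
  out : List β

/-- A piece of a transducer with a single work tape. Instead of halting, it is left through one of
the exits `E`. -/
structure Fragment (α β κ E : Type) where
  Q : Type
  finQ : Finite Q
  start : Q
  δ : Q → InSym α → TapeSym κ → (Q ⊕ E) × Move × TapeSym κ × Move × Option β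

namespace Fragment

variable {α β κ E E' : Type} {w : List α} {h : ℕ}

/-- One step of a fragment, which leads to another state or to an exit. -/
def step (F : Fragment α β κ E) (w : List α) (q : F.Q) (m : Memory β κ) :
    (F.Q ⊕ E) × Memory β κ :=
  let r := F.δ q (Transducer.readInput w m.inHead) (m.tape m.head)
  (r.1,
    { inHead := min (r.2.1.apply m.inHead) (w.length + 1)
      head := r.2.2.2.1.apply m.head
      tape := Function.update m.tape m.head r.2.2.1
      out := m.out ++ r.2.2.2.2.toList })

/-- `F.Run w h q m e m'`: from state `q` and memory `m`, the fragment `F` reaches the exit `e` with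
memory `m'`, and scans only the cells `0, …, h` of the work tape. -/
inductive Run (F : Fragment α β κ E) (w : List α) (h : ℕ) :
    F.Q → Memory β κ → E → Memory β κ → Prop
  | exit {q m e m'} (hm : m.head ≤ h) (hs : F.step w q m = (Sum.inr e, m')) : Run F w h q m e m'
  | next {q m q' m' e m''} (hm : m.head ≤ h) (hs : F.step w q m = (Sum.inl q', m'))
      (hr : Run F w h q' m' e m'') : Run F w h q m e m''

/-- Run `F`, then continue with the fragment that belongs to the exit taken. -/
def bind [Finite E] (F : Fragment α β κ E) (G : E → Fragment α β κ E') : Fragment α β κ E' where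
  Q := F.Q ⊕ Σ e, (G e).Q
  finQ := by
    have := F.finQ
    have := fun e => (G e).finQ
    infer_instance
  start := Sum.inl F.start
  δ := fun q a s => match q with
    | .inl q =>
      let r := F.δ q a s
      (Sum.inl (r.1.elim Sum.inl fun e => Sum.inr ⟨e, (G e).start⟩), r.2)
    | .inr ⟨e, q⟩ =>
      let r := (G e).δ q a s
      (r.1.map (fun q => Sum.inr ⟨e, q⟩) id, r.2)

/-- Repeat `F` as long as it is left through the exit `none`. -/
def iter (F : Fragment α β κ (Option E)) : Fragment α β κ E where
  Q := F.Q
  finQ := F.finQ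
  start := F.start
  δ := fun q a s =>
    let r := F.δ q a s
    (r.1.elim Sum.inl fun e => e.elim (Sum.inl F.start) Sum.inr, r.2)

section Run

variable {m m' m'' : Memory β κ} {e : E} {e' : E'}

theorem Run.bind_right [Finite E] {F : Fragment α β κ E} {G : E → Fragment α β κ E'} {q}
    (hr : (G e).Run w h q m e' m') : (bind F G).Run w h (Sum.inr ⟨e, q⟩) m e' m' := by
  have hstep (q : (G e).Q) (m : Memory β κ) : (F.bind G).step w (.inr ⟨e, q⟩) m =
      (((G e).step w q m).1.map (fun q => .inr ⟨e, q⟩) id, ((G e).step w q m).2) := rfl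
  induction hr with
  | exit hm hs => exact .exit hm (by rw [hstep, hs]; rfl)
  | next hm hs _ ih => exact .next hm (by rw [hstep, hs]; rfl) ih

theorem Run.bind [Finite E] {F : Fragment α β κ E} {G : E → Fragment α β κ E'} {q}
    (hr : F.Run w h q m e m') (hr' : (G e).Run w h (G e).start m' e' m'') :
    (bind F G).Run w h (Sum.inl q) m e' m'' := by
  have hstep (q : F.Q) (m : Memory β κ) : (F.bind G).step w (.inl q) m =
      (.inl ((F.step w q m).1.elim .inl fun e => .inr ⟨e, (G e).start⟩), (F.step w q m).2) := rfl
  induction hr with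
  | exit hm hs => exact .next hm (by rw [hstep, hs]; rfl) hr'.bind_right
  | next hm hs _ ih => exact .next hm (by rw [hstep, hs]; rfl) (ih hr')

theorem step_iter (F : Fragment α β κ (Option E)) (q : F.Q) (m : Memory β κ) :
    F.iter.step w q m = ((F.step w q m).1.elim Sum.inl fun o => o.elim (Sum.inl F.start) Sum.inr,
      (F.step w q m).2) := rfl

theorem Run.iter_some {F : Fragment α β κ (Option E)} {q} (hr : F.Run w h q m (some e) m') :
    F.iter.Run w h q m e m' := by
  generalize ho : some e = o at hr
  induction hr with
  | exit hm hs => exact .exit hm (by rw [step_iter, hs, ← ho]; rfl)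
  | next hm hs _ ih => exact .next (F := F.iter) hm (by rw [step_iter, hs]; rfl) (ih ho)

theorem Run.iter_none {F : Fragment α β κ (Option E)} {q} (hr : F.Run w h q m none m')
    (hr' : F.iter.Run w h F.start m' e m'') : F.iter.Run w h q m e m'' := by
  generalize ho : none = o at hr
  induction hr with
  | exit hm hs => exact .next (F := F.iter) hm (by rw [step_iter, hs, ← ho]; rfl) hr'
  | next hm hs _ ih => exact .next (F := F.iter) hm (by rw [step_iter, hs]; rfl) (ih hr' ho)

end Run

/-- One step that branches on the input symbol, moves the input head, and outputs at most one
letter. -/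
def single (e : InSym α → E) (d : Move) (b : Option β) : Fragment α β κ E where
  Q := Unit
  finQ := inferInstance
  start := ()
  δ := fun _ a s => (Sum.inr (e a), d, s, Move.stay, b)

/-- Write the left end mark. -/
def putMark : Fragment α β κ Unit where
  Q := Unit
  finQ := inferInstance
  start := ()
  δ := fun _ _ _ => (Sum.inr (), Move.stay, some none, Move.stay, none)

/-- Run a sequential machine with the initial state `s₀` and the transition function `f` over the
columns from left to right, append the column given by `ext` if there is one, go back to the left
end and take the exit given by `res`. -/
def sweep {σ : Type} [Finite σ] (s₀ : σ) (f : σ → (κ → Bool) → σ × (κ → Bool))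
    (ext : σ → Option (κ → Bool)) (res : σ → E) : Fragment α β κ E where
  Q := Unit ⊕ σ ⊕ σ
  finQ := inferInstance
  start := Sum.inl ()
  δ := fun q _ a => match q with
    | .inl _ => (Sum.inl (.inr (.inl s₀)), .stay, a, .right, none)
    | .inr (.inl s) => match a with
      | some (some c) =>
        (Sum.inl (.inr (.inl (f s c).1)), .stay, some (some (f s c).2), .right, none)
      | _ => (Sum.inl (.inr (.inr s)), .stay, (ext s).map some, .left, none)
    | .inr (.inr s) => match a with
      | some (some c) => (Sum.inl (.inr (.inr s)), .stay, some (some c), .left, none)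
      | _ => (Sum.inr (res s), .stay, a, .stay, none)

/-- The tape with the left end mark on cell `0` followed by the columns `l`. -/
def tapeOf (l : List (κ → Bool)) : ℕ → TapeSym κ
  | 0 => some none
  | i + 1 => l[i]?.map some

theorem tapeOf_append_cons (l l' : List (κ → Bool)) (x : κ → Bool) :
    tapeOf (l ++ x :: l') (l.length + 1) = some (some x) := by
  simp [tapeOf]

theorem tapeOf_length (l : List (κ → Bool)) : tapeOf l (l.length + 1) = none := by
  simp [tapeOf]

theorem update_tapeOf_append_cons (l l' : List (κ → Bool)) (x y : κ → Bool) :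
    Function.update (tapeOf (l ++ x :: l')) (l.length + 1) (some (some y)) =
      tapeOf (l ++ y :: l') := by
  funext i
  rcases i with _ | i
  · rfl
  · rcases lt_trichotomy i l.length with hi | rfl | hi
    · simp [tapeOf, hi.ne, List.getElem?_append_left hi]
    · simp [tapeOf]
    · obtain ⟨k, rfl⟩ := Nat.exists_eq_add_of_lt hi
      simp [tapeOf, add_assoc, List.getElem?_append_right]

theorem update_tapeOf_length (l : List (κ → Bool)) (x : Option (κ → Bool)) :
    Function.update (tapeOf l) (l.length + 1) (x.map some) = tapeOf (l ++ x.toList) := by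
  funext i
  rcases i with _ | i
  · rfl
  · rcases lt_trichotomy i l.length with hi | rfl | hi
    · simp [tapeOf, hi.ne, List.getElem?_append_left hi]
    · cases x <;> simp [tapeOf]
    · obtain ⟨k, rfl⟩ := Nat.exists_eq_add_of_lt hi
      cases x <;> simp [tapeOf, add_assoc]

/-- The final state and the output word of a sequential machine. -/
def mealy {σ X : Type} (f : σ → X → σ × X) : σ → List X → σ × List X
  | s, [] => (s, [])
  | s, x :: l => ((mealy f (f s x).1 l).1, (f s x).2 :: (mealy f (f s x).1 l).2)

theorem length_mealy {σ X : Type} (f : σ → X → σ × X) (s : σ) (l : List X) :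
    (mealy f s l).2.length = l.length := by
  induction l generalizing s with
  | nil => rfl
  | cons x l ih => simp only [mealy, List.length_cons, ih]

section Sweep

variable {σ : Type} [Finite σ] (s₀ : σ) (f : σ → (κ → Bool) → σ × (κ → Bool))
  (ext : σ → Option (κ → Bool)) (res : σ → E) {i : ℕ} (out : List β)

/-- The columns that `sweep` leaves on the tape. -/
def swept (l : List (κ → Bool)) : List (κ → Bool) :=
  (mealy f s₀ l).2 ++ (ext (mealy f s₀ l).1).toList

theorem run_sweep_back (hi : i ≤ w.length + 1) (l : List (κ → Bool)) (s : σ) {p : ℕ}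
    (hp : p ≤ l.length) (hh : p ≤ h) :
    (sweep s₀ f ext res).Run w h (.inr (.inr s)) ⟨i, p, tapeOf l, out⟩
      (res s) ⟨i, 0, tapeOf l, out⟩ := by
  induction p with
  | zero => exact .exit hh (by simp [step, sweep, tapeOf, Move.apply, hi])
  | succ p ih =>
    have hcell : tapeOf l (p + 1) = some (some l[p]) := by simp [tapeOf, Nat.lt_of_succ_le hp]
    refine .next (F := sweep s₀ f ext res) (q' := Sum.inr (.inr s)) hh ?_ (ih (by omega) (by omega))
    simp only [step, sweep, hcell, Move.apply, min_eq_left hi, Nat.add_sub_cancel,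
      Option.toList_none, List.append_nil]
    rw [← hcell, Function.update_eq_self]

theorem run_sweep_right (hi : i ≤ w.length + 1) (l pre : List (κ → Bool)) (s : σ)
    (hh : pre.length + l.length + 1 ≤ h) :
    (sweep s₀ f ext res).Run w h (.inr (.inl s)) ⟨i, pre.length + 1, tapeOf (pre ++ l), out⟩
      (res (mealy f s l).1) ⟨i, 0, tapeOf (pre ++ swept s f ext l), out⟩ := by
  induction l generalizing pre s with
  | nil =>
    have hpre : pre.length ≤ h := by simp only [List.length_nil] at hh; omega
    refine .next (F := sweep s₀ f ext res) (q' := Sum.inr (.inr s))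
      (m' := ⟨i, pre.length, tapeOf (pre ++ (ext s).toList), out⟩)
      hh ?_ (run_sweep_back s₀ f ext res out hi _ s (by simp) hpre)
    rw [← update_tapeOf_length]
    simp [step, sweep, tapeOf_length, Move.apply, hi]
  | cons x l ih =>
    have hrest := ih (pre ++ [(f s x).2]) (f s x).1 (by simp at hh ⊢; omega)
    simp only [List.append_assoc, List.singleton_append, List.length_append,
      List.length_singleton] at hrest
    refine .next (F := sweep s₀ f ext res) (q' := Sum.inr (.inl (f s x).1))
      (by simp at hh ⊢; omega) ?_ hrest
    simp [step, sweep, tapeOf_append_cons, Move.apply, hi, update_tapeOf_append_cons]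

theorem run_sweep (hi : i ≤ w.length + 1) (l : List (κ → Bool)) (hh : l.length + 1 ≤ h) :
    (sweep s₀ f ext res).Run w h (sweep (α := α) (β := β) s₀ f ext res).start
      ⟨i, 0, tapeOf l, out⟩ (res (mealy f s₀ l).1) ⟨i, 0, tapeOf (swept s₀ f ext l), out⟩ := by
  refine .next (F := sweep s₀ f ext res) (q' := Sum.inr (.inl s₀)) (Nat.zero_le _) ?_
    (run_sweep_right s₀ f ext res out hi l [] s₀ (by simpa using hh))
  simp [step, sweep, Move.apply, hi]

end Sweep

end Fragment

/-- The transducer that runs a fragment and halts. -/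
def Fragment.toTransducer {α β κ : Type} [Finite κ] (F : Fragment α β κ Unit) :
    Transducer α β where
  k := 1
  Q := Option F.Q
  Γ := TapeSym κ
  finQ := have := F.finQ; inferInstance
  finΓ := inferInstance
  blank := none
  start := some F.start
  δ := fun q a s => q.map fun q =>
    let r := F.δ q a (s 0)
    (r.1.elim some fun _ => none, r.2.1, fun _ => (r.2.2.1, r.2.2.2.1), r.2.2.2.2)

section ToTransducer

variable {α β κ : Type} [Finite κ]

/-- The configuration of the transducer of `F` with the given state and memory. -/
def Memory.toCfg (F : Fragment α β κ Unit) (q : Option F.Q) (m : Memory β κ) :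
    F.toTransducer.Cfg where
  state := q
  inHead := m.inHead
  heads := fun _ => m.head
  tapes := fun _ => m.tape
  out := m.out

namespace Fragment

variable (F : Fragment α β κ Unit) {w : List α} {h : ℕ}

theorem step_toTransducer_some (w : List α) (q : F.Q) (m : Memory β κ) :
    F.toTransducer.step w (m.toCfg F (some q)) =
      some ((F.step w q m).2.toCfg F ((F.step w q m).1.elim some fun _ => none)) := rfl

theorem step_toTransducer_none (w : List α) (m : Memory β κ) :
    F.toTransducer.step w (m.toCfg F none) = none := rfl

variable {F} {q : F.Q} {m m' : Memory β κ}

theorem Run.reaches_toTransducer {e : Unit} (hr : F.Run w h q m e m') :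
    StateTransition.Reaches (F.toTransducer.step w) (m.toCfg F (some q)) (m'.toCfg F none) := by
  induction hr with
  | exit _ hs => exact .single (by rw [step_toTransducer_some, hs]; rfl)
  | next _ hs _ ih => exact .head (by rw [step_toTransducer_some, hs]; rfl) ih

theorem Run.heads_le_of_reaches {e : Unit} (hr : F.Run w h q m e m') (hm' : m'.head ≤ h)
    {c : F.toTransducer.Cfg}
    (hc : StateTransition.Reaches (F.toTransducer.step w) (m.toCfg F (some q)) c)
    (i : Fin F.toTransducer.k) : c.heads i ≤ h := by
  induction hr with
  | exit hm hs =>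
    rcases Relation.ReflTransGen.cases_head hc with rfl | ⟨c', hs', hc⟩
    · exact hm
    · obtain rfl : Memory.toCfg F none _ = c' := by
        rw [step_toTransducer_some, hs] at hs'; exact Option.some.inj hs'
      rcases Relation.ReflTransGen.cases_head hc with rfl | ⟨c'', hs'', -⟩
      · exact hm'
      · rw [step_toTransducer_none] at hs''; cases hs''
  | next hm hs _ ih =>
    rcases Relation.ReflTransGen.cases_head hc with rfl | ⟨c', hs', hc⟩
    · exact hm
    · obtain rfl : Memory.toCfg F (some _) _ = c' := by
        rw [step_toTransducer_some, hs] at hs'; exact Option.some.inj hs'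
      exact ih hm' hc

end Fragment

end ToTransducer

/-! ### Binary counters -/

/-- The number that the counter `c` has in the columns `l`, the least significant digit first. -/
def columnValue {κ : Type} (l : List (κ → Bool)) (c : κ) : ℕ :=
  Nat.ofDigits 2 (l.map fun x => (x c).toNat)

section ColumnValue

variable {κ : Type}

theorem columnValue_nil : columnValue ([] : List (κ → Bool)) = 0 := rfl

theorem columnValue_cons (x : κ → Bool) (l : List (κ → Bool)) (c : κ) :
    columnValue (x :: l) c = (x c).toNat + 2 * columnValue l c := by
  simp [columnValue, Nat.ofDigits_cons]

theorem columnValue_append (l l' : List (κ → Bool)) (c : κ) :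
    columnValue (l ++ l') c = columnValue l c + 2 ^ l.length * columnValue l' c := by
  simp [columnValue, Nat.ofDigits_append]

theorem columnValue_eq_iff (l : List (κ → Bool)) (c d : κ) :
    columnValue l c = columnValue l d ↔ ∀ x ∈ l, x c = x d := by
  induction l with
  | nil => simp [columnValue_nil]
  | cons x l ih =>
    rw [columnValue_cons, columnValue_cons, List.forall_mem_cons, ← ih]
    cases x c <;> cases x d <;> simp <;> omega

end ColumnValue

namespace Fragment

variable {α β κ E E' : Type} {w : List α} {H : ℕ}

/-- The memory `m` holds the counter values `v` in at most `H` columns, the work tape head is at the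
left end, and the input head is on cell `i`. -/
def Represents (w : List α) (H : ℕ) (v : κ → ℕ) (i : ℕ) (m : Memory β κ) : Prop :=
  m.inHead = i ∧ i ≤ w.length + 1 ∧ m.head = 0 ∧
    ∃ l : List (κ → Bool), l.length ≤ H ∧ m.tape = tapeOf l ∧ columnValue l = v

/-- Started with counter values `v` and input head position `i`, the fragment is left through the
exit `e` with counter values `v'`, input head position `i'` and additional output `o`. -/
def Does (F : Fragment α β κ E) (w : List α) (H : ℕ) (v : κ → ℕ) (i : ℕ) (e : E) (v' : κ → ℕ)
    (i' : ℕ) (o : List β) : Prop :=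
  ∀ m : Memory β κ, Represents w H v i m → ∃ m' : Memory β κ,
    F.Run w (H + 1) F.start m e m' ∧ Represents w H v' i' m' ∧ m'.out = m.out ++ o

section Does

variable {v v' v'' : κ → ℕ} {i i' i'' : ℕ} {o o' : List β} {e : E}

theorem Does.bind [Finite E] {F : Fragment α β κ E} {G : E → Fragment α β κ E'} {e' : E'}
    (h : F.Does w H v i e v' i' o) (h' : (G e).Does w H v' i' e' v'' i'' o') :
    (bind F G).Does w H v i e' v'' i'' (o ++ o') := by
  intro m hm
  obtain ⟨m', hr, hm', ho⟩ := h m hm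
  obtain ⟨m'', hr', hm'', ho'⟩ := h' m' hm'
  exact ⟨m'', hr.bind hr', hm'', by rw [ho', ho, List.append_assoc]⟩

theorem Does.iter_some {F : Fragment α β κ (Option E)}
    (h : F.Does w H v i (some e) v' i' o) : F.iter.Does w H v i e v' i' o := by
  intro m hm
  obtain ⟨m', hr, hm', ho⟩ := h m hm
  exact ⟨m', hr.iter_some, hm', ho⟩

theorem Does.iter_none {F : Fragment α β κ (Option E)} (h : F.Does w H v i none v' i' o)
    (h' : F.iter.Does w H v' i' e v'' i'' o') : F.iter.Does w H v i e v'' i'' (o ++ o') := by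
  intro m hm
  obtain ⟨m', hr, hm', ho⟩ := h m hm
  obtain ⟨m'', hr', hm'', ho'⟩ := h' m' hm'
  exact ⟨m'', hr.iter_none hr', hm'', by rw [ho', ho, List.append_assoc]⟩

theorem does_of_le {F : Fragment α β κ E} (h : i ≤ w.length + 1 → F.Does w H v i e v' i' o) :
    F.Does w H v i e v' i' o :=
  fun m hm => h hm.2.1 m hm

end Does

theorem does_single (e : InSym α → E) (d : Move) (b : Option β) (v : κ → ℕ) (i : ℕ) :
    (single e d b).Does w H v i (e (Transducer.readInput w i)) v (min (d.apply i) (w.length + 1))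
      b.toList := by
  rintro ⟨i', p, t, out⟩ ⟨rfl, hi, rfl, l, hl, rfl, hv⟩
  refine ⟨⟨min (d.apply i') (w.length + 1), 0, tapeOf l, out ++ b.toList⟩,
    .exit (Nat.zero_le _) ?_, ⟨rfl, min_le_right _ _, rfl, l, hl, rfl, hv⟩, rfl⟩
  simp [step, single, Move.apply]

theorem does_single_stay (e : InSym α → E) (b : Option β) (v : κ → ℕ) (i : ℕ) :
    (single e .stay b).Does w H v i (e (Transducer.readInput w i)) v i b.toList :=
  does_of_le fun hi => by
    have := does_single (w := w) (H := H) e .stay b v i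
    rwa [Move.apply, min_eq_left hi] at this

theorem does_sweep {σ : Type} [Finite σ] {s₀ : σ} {f : σ → (κ → Bool) → σ × (κ → Bool)}
    {ext : σ → Option (κ → Bool)} {res : σ → E} {v v' : κ → ℕ} {e : E}
    (h : ∀ l : List (κ → Bool), l.length ≤ H → columnValue l = v →
      res (mealy f s₀ l).1 = e ∧ (swept s₀ f ext l).length ≤ H ∧
        columnValue (swept s₀ f ext l) = v') (i : ℕ) :
    (sweep (α := α) (β := β) s₀ f ext res).Does w H v i e v' i [] := by
  rintro ⟨i', p, t, out⟩ ⟨rfl, hi, rfl, l, hl, rfl, hv⟩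
  obtain ⟨rfl, hlen, hv'⟩ := h l hl hv
  exact ⟨_, run_sweep s₀ f ext res out hi l (by omega), ⟨rfl, hi, rfl, _, hlen, rfl, hv'⟩,
    (List.append_nil _).symm⟩

/-- Branch on whether two counters are equal. -/
def test (c d : κ) : Fragment α β κ Bool :=
  sweep true (fun s x => (s && x c == x d, x)) (fun _ => none) id

theorem mealy_test (c d : κ) (s : Bool) (l : List (κ → Bool)) :
    mealy (fun (s : Bool) (x : κ → Bool) => (s && x c == x d, x)) s l =
      (s && decide (∀ x ∈ l, x c = x d), l) := by
  induction l generalizing s with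
  | nil => simp [mealy]
  | cons x l ih => rw [mealy, ih]; simp [beq_eq_decide, Bool.and_assoc]

theorem does_test (c d : κ) (v : κ → ℕ) (i : ℕ) :
    (test (α := α) (β := β) c d).Does w H v i (decide (v c = v d)) v i [] := by
  refine does_sweep (fun l hl hv => ?_) i
  simp [mealy_test, swept, ← columnValue_eq_iff, hl, hv]

variable [DecidableEq κ]

/-- Set a counter to `0`. -/
def zero (c : κ) : Fragment α β κ Unit :=
  sweep () (fun _ x => ((), Function.update x c false)) (fun _ => none) id

theorem mealy_zero (c : κ) (l : List (κ → Bool)) :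
    mealy (fun (_ : Unit) (x : κ → Bool) => ((), Function.update x c false)) () l =
      ((), l.map fun x => Function.update x c false) := by
  induction l with
  | nil => rfl
  | cons x l ih => simp [mealy, ih]

theorem columnValue_map_update_false (c : κ) (l : List (κ → Bool)) :
    columnValue (l.map fun x => Function.update x c false) =
      Function.update (columnValue l) c 0 := by
  funext d
  induction l with
  | nil => by_cases hd : d = c <;> simp [columnValue_nil, hd]
  | cons x l ih =>
    rw [List.map_cons, columnValue_cons, ih]
    by_cases hd : d = c <;> simp [hd, columnValue_cons]

theorem does_zero (c : κ) (v : κ → ℕ) (i : ℕ) :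
    (zero (α := α) (β := β) c).Does w H v i () (Function.update v c 0) i [] :=
  does_sweep (fun l hl hv => by simp [mealy_zero, swept, columnValue_map_update_false, hl, hv]) i

/-- Add the carry `s` to the digit of the counter `c`; the result contains the new carry. -/
def addCarry (c : κ) (s : Bool) (x : κ → Bool) : Bool × (κ → Bool) :=
  (s && x c, Function.update x c (s ^^ x c))

/-- Increment a counter. -/
def inc (c : κ) : Fragment α β κ Unit :=
  sweep true (addCarry c)
    (fun s => if s then some (Function.update (fun _ => false) c true) else none) fun _ => ()

theorem columnValue_mealy_addCarry_self (c : κ) (s : Bool) (l : List (κ → Bool)) :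
    columnValue (mealy (addCarry c) s l).2 c + (mealy (addCarry c) s l).1.toNat * 2 ^ l.length =
      columnValue l c + s.toNat := by
  induction l generalizing s with
  | nil => simp [mealy, columnValue_nil]
  | cons x l ih =>
    have hcarry : (s && x c).toNat * 2 + (s ^^ x c).toNat = (x c).toNat + s.toNat := by
      cases s <;> cases x c <;> rfl
    have := ih (s && x c)
    simp only [mealy, addCarry, columnValue_cons, List.length_cons, pow_succ,
      Function.update_self] at this ⊢
    linarith

theorem columnValue_mealy_addCarry_of_ne {c d : κ} (hd : d ≠ c) (s : Bool) (l : List (κ → Bool)) :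
    columnValue (mealy (addCarry c) s l).2 d = columnValue l d := by
  induction l generalizing s with
  | nil => rfl
  | cons x l ih => simp only [mealy, columnValue_cons, ih, addCarry, Function.update_of_ne hd]

theorem does_inc {c : κ} {v : κ → ℕ} (hc : v c + 1 < 2 ^ H) (i : ℕ) :
    (inc (α := α) (β := β) c).Does w H v i () (Function.update v c (v c + 1)) i [] := by
  refine does_sweep (fun l hl hv => ⟨rfl, ?_, ?_⟩) i
  · have hself := columnValue_mealy_addCarry_self c true l
    simp only [swept, List.length_append, length_mealy]
    split_ifs with hs
    · rw [hs, hv, Bool.toNat_true] at hself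
      have : l.length < H := (Nat.pow_lt_pow_iff_right one_lt_two).1 (by omega : 2 ^ l.length < _)
      simpa using this
    · simpa using hl
  · funext d
    simp only [swept, columnValue_append, length_mealy]
    by_cases hd : d = c
    · subst hd
      rw [Function.update_self, ← hv, ← Bool.toNat_true, ← columnValue_mealy_addCarry_self d true l]
      split_ifs with hs <;> simp [hs, columnValue_cons, columnValue_nil]
    · rw [Function.update_of_ne hd, columnValue_mealy_addCarry_of_ne hd, hv]
      split_ifs <;> simp [columnValue_cons, columnValue_nil, hd]

end Fragment

/-! ### Structured programs -/

namespace Fragment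

variable {α β κ E : Type} {w : List α} {H : ℕ}

/-- One fragment after another. -/
def seq (F : Fragment α β κ Unit) (G : Fragment α β κ E) : Fragment α β κ E := bind F fun _ => G

theorem Does.seq {F : Fragment α β κ Unit} {G : Fragment α β κ E} {v i v' i' o e v'' i'' o'}
    (h : F.Does w H v i () v' i' o) (h' : G.Does w H v' i' e v'' i'' o') :
    (seq F G).Does w H v i e v'' i'' (o ++ o') :=
  Does.bind h h'

/-- Leave at once through the exit `e`. -/
def skip (e : E) : Fragment α β κ E := single (fun _ => e) .stay none

theorem does_skip (e : E) (v : κ → ℕ) (i : ℕ) :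
    (skip (β := β) e).Does w H v i e v i [] :=
  does_single_stay (fun _ => e) none v i

/-- Output one letter. -/
def emit (b : β) : Fragment α β κ Unit := single (fun _ => ()) .stay (some b)

theorem does_emit (b : β) (v : κ → ℕ) (i : ℕ) : (emit b).Does w H v i () v i [b] :=
  does_single_stay (fun _ => ()) (some b) v i

/-- Output a word. -/
def emitWord : List β → Fragment α β κ Unit
  | [] => skip ()
  | b :: l => seq (emit b) (emitWord l)

theorem does_emitWord (l : List β) (v : κ → ℕ) (i : ℕ) :
    (emitWord l).Does w H v i () v i l := by
  induction l with
  | nil => exact does_skip () v i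
  | cons b l ih => exact (does_emit b v i).seq ih

/-- `F` repeated `n` times. -/
def repeatN (F : Fragment α β κ Unit) : ℕ → Fragment α β κ Unit
  | 0 => skip ()
  | n + 1 => seq (repeatN F n) F

theorem does_repeatN {F : Fragment α β κ Unit} {V : ℕ → κ → ℕ} {I : ℕ → ℕ} (n : ℕ)
    (h : ∀ t < n, F.Does w H (V t) (I t) () (V (t + 1)) (I (t + 1)) []) :
    (repeatN F n).Does w H (V 0) (I 0) () (V n) (I n) [] := by
  induction n with
  | zero => exact does_skip () _ _
  | succ n ih => exact (ih fun t ht => h t (ht.trans n.lt_succ_self)).seq (h n n.lt_succ_self)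

/-- Move the input head to the right. -/
def moveRight : Fragment α β κ Unit := single (fun _ => ()) .right none

theorem does_moveRight (v : κ → ℕ) (i : ℕ) :
    (moveRight (β := β)).Does w H v (min i (w.length + 1)) () v (min (i + 1) (w.length + 1))
      [] := by
  have hmove : min (Move.right.apply (min i (w.length + 1))) (w.length + 1) =
      min (i + 1) (w.length + 1) := by
    simp only [Move.apply]; omega
  exact hmove ▸ does_single (fun _ => ()) .right none v (min i (w.length + 1))

/-- Repeat the following: read the input, move the input head in direction `d`, and run `F`,
until the symbol read satisfies `p`; then `F` is not run. -/
def scan (p : InSym α → Bool) (d : Move) (F : Fragment α β κ Unit) : Fragment α β κ Unit :=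
  iter (bind (single p d none) fun b => if b then skip (some ()) else seq F (skip none))

theorem does_scan {p : InSym α → Bool} {d : Move} {F : Fragment α β κ Unit} {V : ℕ → κ → ℕ}
    {I : ℕ → ℕ} {n : ℕ} (hp : ∀ t < n, p (Transducer.readInput w (I t)) = false)
    (hpn : p (Transducer.readInput w (I n)) = true)
    (hI : ∀ t ≤ n, min (d.apply (I t)) (w.length + 1) = I (t + 1))
    (hF : ∀ t < n, F.Does w H (V t) (I (t + 1)) () (V (t + 1)) (I (t + 1)) []) :
    (scan p d F).Does w H (V 0) (I 0) () (V n) (I (n + 1)) [] := by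
  have hpass (t : ℕ) : (single (β := β) p d none).Does w H (V t) (I t)
      (p (Transducer.readInput w (I t))) (V t) _ [] := does_single p d none (V t) (I t)
  have hscan : ∀ k t, t + k = n →
      (scan p d F).Does w H (V t) (I t) () (V n) (I (n + 1)) [] := by
    intro k
    induction k with
    | zero =>
      intro t ht
      obtain rfl : t = n := ht
      refine ((hpass t).bind (o' := []) ?_).iter_some
      rw [hpn, hI t le_rfl]
      exact does_skip _ _ _
    | succ k ih =>
      intro t ht
      refine ((hpass t).bind (o' := []) ?_).iter_none (ih (t + 1) (by omega))
      rw [hp t (by omega), hI t (by omega)]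
      exact (hF t (by omega)).seq (does_skip none _ _)
  exact hscan n 0 (zero_add n)

/-- Whether a symbol is the left end marker. -/
def isLeftEnd : InSym α → Bool
  | .leftEnd => true
  | _ => false

/-- Whether a symbol is the right end marker. -/
def isRightEnd : InSym α → Bool
  | .rightEnd => true
  | _ => false

theorem isLeftEnd_readInput_succ (w : List α) (i : ℕ) :
    isLeftEnd (Transducer.readInput w (i + 1)) = false := by
  simp only [Transducer.readInput]
  cases w[i]? <;> rfl

theorem isRightEnd_readInput_of_le {i : ℕ} (hi : i ≤ w.length) :
    isRightEnd (Transducer.readInput w i) = false := by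
  cases i with
  | zero => rfl
  | succ i => simp only [Transducer.readInput, List.getElem?_eq_getElem hi]; rfl

/-- Move the input head to the left end marker. -/
def rewind : Fragment α β κ Unit := scan isLeftEnd .left (skip ())

theorem does_rewind (v : κ → ℕ) (i : ℕ) : (rewind (β := β)).Does w H v i () v 0 [] := by
  refine does_of_le fun hi => ?_
  have := does_scan (β := β) (w := w) (H := H) (p := isLeftEnd) (d := .left) (F := skip ())
    (V := fun _ => v) (I := fun t => i - t) (n := i)
    (fun t ht => by
      obtain ⟨j, hj⟩ := Nat.exists_eq_succ_of_ne_zero (Nat.sub_ne_zero_of_lt ht)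
      simp only [hj, isLeftEnd_readInput_succ])
    (by rw [Nat.sub_self]; rfl) (fun t _ => by simp only [Move.apply]; omega)
    fun t _ => does_skip () v _
  simpa [rewind] using this

variable [DecidableEq κ]

/-- One pass of a loop over `c` up to `d`; the exit `some ()` ends the loop. -/
def forStep (c d : κ) (F : Fragment α β κ Unit) : Fragment α β κ (Option Unit) :=
  bind (test c d) fun b => if b then skip (some ()) else seq F (seq (inc c) (skip none))

/-- `for c = 0, 1, …, d - 1` do `F`; the counter `c` is `0` before and after. -/
def forLoop (c d : κ) (F : Fragment α β κ Unit) : Fragment α β κ Unit :=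
  seq (iter (forStep c d F)) (zero c)

theorem does_forStep_some (c d : κ) (F : Fragment α β κ Unit) {v : κ → ℕ} (hv : v c = v d) (i : ℕ) :
    (forStep c d F).Does w H v i (some ()) v i [] := by
  refine Does.bind (o := []) (does_test c d v i) ?_
  rw [if_pos (by simpa using hv)]
  exact does_skip _ v i

theorem does_forStep_none {c d : κ} {F : Fragment α β κ Unit} {v v' : κ → ℕ} {i i' : ℕ}
    {o : List β} (hv : v c ≠ v d) (hF : F.Does w H v i () v' i' o) (hv' : v' c + 1 < 2 ^ H) :
    (forStep c d F).Does w H v i none (Function.update v' c (v' c + 1)) i' o := by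
  refine Does.bind (o := []) (does_test c d v i) ?_
  rw [if_neg (by simpa using hv)]
  simpa only [List.append_nil] using hF.seq ((does_inc hv' i').seq (does_skip none _ i'))

theorem does_forLoop {c d : κ} (hc : c ≠ d) {F : Fragment α β κ Unit} {V : ℕ → κ → ℕ} {I : ℕ → ℕ}
    {o : ℕ → List β} {n : ℕ} (hVc : ∀ t, V t c = 0) (hVd : ∀ t, V t d = n) (hn : n < 2 ^ H)
    (h : ∀ t < n, F.Does w H (Function.update (V t) c t) (I t) ()
      (Function.update (V (t + 1)) c t) (I (t + 1)) (o t)) :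
    (forLoop c d F).Does w H (V 0) (I 0) () (V n) (I n) ((List.range n).flatMap o) := by
  have hloop : ∀ k t, t + k = n → (iter (forStep c d F)).Does w H (Function.update (V t) c t) (I t)
      () (Function.update (V n) c n) (I n) ((List.range' t k).flatMap o) := by
    intro k
    induction k with
    | zero =>
      rintro t rfl
      exact (does_forStep_some c d F (by simp [hc.symm, hVd]) _).iter_some
    | succ k ih =>
      intro t ht
      have hstep := does_forStep_none (c := c) (d := d) (v := Function.update (V t) c t)
        (by simp [hc.symm, hVd]; omega) (h t (by omega)) (by simp; omega)
      rw [Function.update_self, Function.update_idem] at hstep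
      exact hstep.iter_none (ih (t + 1) (by omega))
  have hiter := hloop n 0 (zero_add n)
  have hzero := does_zero (α := α) (β := β) (w := w) (H := H) c (Function.update (V n) c n) (I n)
  rw [Function.update_idem, ← hVc n, Function.update_eq_self] at hzero
  rw [Function.update_eq_self_iff.2 (hVc 0).symm, ← List.range_eq_range'] at hiter
  have := hiter.seq hzero
  rwa [List.append_nil] at this

theorem does_forLoop_const {c d : κ} (hc : c ≠ d) {F : Fragment α β κ Unit} {v : κ → ℕ} {i : ℕ}
    {o : ℕ → List β} (hvc : v c = 0) (hvd : v d < 2 ^ H)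
    (h : ∀ t < v d, F.Does w H (Function.update v c t) i () (Function.update v c t) i (o t)) :
    (forLoop c d F).Does w H v i () v i ((List.range (v d)).flatMap o) :=
  does_forLoop (V := fun _ => v) (I := fun _ => i) hc (fun _ => hvc) (fun _ => rfl) hvd h

/-- Add `d ^ l.length` to the counter `c` by loops up to `d` over the counters `l`, one inside the
other. -/
def addPow (c d : κ) : List κ → Fragment α β κ Unit
  | [] => inc c
  | a :: l => forLoop a d (addPow c d l)

theorem does_addPow {c d : κ} {l : List κ} (hl : (d :: c :: l).Nodup) {v : κ → ℕ}
    (hv : ∀ a ∈ l, v a = 0) (hd : v d < 2 ^ H) (hlt : v c + v d ^ l.length < 2 ^ H) (i : ℕ) :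
    (addPow (α := α) (β := β) c d l).Does w H v i ()
      (Function.update v c (v c + v d ^ l.length)) i [] := by
  induction l generalizing v with
  | nil => exact does_inc hlt i
  | cons a l ih =>
    obtain ⟨⟨hdc, hda, hdl⟩, ⟨hca, hcl⟩, hal, hnodup⟩ :
        (d ≠ c ∧ d ≠ a ∧ d ∉ l) ∧ (c ≠ a ∧ c ∉ l) ∧ a ∉ l ∧ l.Nodup := by simpa [not_or] using hl
    have hva : v a = 0 := hv a List.mem_cons_self
    let V (t : ℕ) : κ → ℕ := Function.update v c (v c + t * v d ^ l.length)
    have hloop := does_forLoop (α := α) (β := β) (w := w) (H := H) (c := a) (d := d)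
      (F := addPow c d l) (V := V) (I := fun _ => i) (o := fun _ => []) (n := v d) hda.symm
      (fun t => by simp [V, hca.symm, hva]) (fun t => by simp [V, hdc]) hd fun t ht => by
        have hstep : v c + (t + 1) * v d ^ l.length < 2 ^ H := by
          refine lt_of_le_of_lt ?_ hlt
          rw [List.length_cons, pow_succ']
          gcongr
          omega
        have := ih (v := Function.update (V t) a t) (by simp [*]) (fun b hb => ?_)
          (by simpa [V, hda, hdc] using hd)
          (by simpa [V, hda, hdc, hca, add_mul, ← add_assoc] using hstep)
        · simpa [V, hda, hdc, hca, add_mul, add_assoc, Function.update_comm hca.symm] using this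
        · have : b ≠ a ∧ b ≠ c := ⟨by rintro rfl; exact hal hb, by rintro rfl; exact hcl hb⟩
          simp [V, this, hv b (List.mem_cons_of_mem _ hb)]
    have hnil : (List.range (v d)).flatMap (fun _ => ([] : List β)) = [] := by simp
    rw [hnil] at hloop
    simpa [addPow, V, pow_succ'] using hloop

/-- Add the number of cells of the input tape before the right end marker to the counter `c`, and
return to the left end marker. -/
def countInput (c : κ) : Fragment α β κ Unit :=
  seq (scan isRightEnd .right (inc c)) rewind

theorem does_countInput {c : κ} {v : κ → ℕ} (hc : v c + w.length + 1 < 2 ^ H) :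
    (countInput (β := β) c).Does w H v 0 () (Function.update v c (v c + w.length + 1)) 0 [] := by
  have hscan := does_scan (β := β) (w := w) (H := H) (p := isRightEnd) (d := .right) (F := inc c)
    (V := fun t => Function.update v c (v c + t))
    (I := fun t => min t (w.length + 1)) (n := w.length + 1)
    (fun t ht => by rw [readInput_min]; exact isRightEnd_readInput_of_le (by omega))
    (by rw [readInput_min, readInput_of_length_lt (Nat.lt_succ_self _)]; rfl)
    (fun t _ => by simp only [Move.apply]; omega)
    fun t ht => by
      have := does_inc (α := α) (β := β) (w := w) (H := H) (c := c)
        (v := Function.update v c (v c + t)) (by rw [Function.update_self]; omega)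
        (min (t + 1) (w.length + 1))
      rwa [Function.update_self, Function.update_idem] at this
  simp only [add_zero, Function.update_eq_self, Nat.zero_min] at hscan
  exact hscan.seq (does_rewind _ _)

end Fragment

/-! ### Schemes -/

/-- Loop programs that produce words over `ℕ × T` from an input word over `α`. A variable from `ι`
holds a number below a bound `S`; `loop x P` runs `P` for every value of `x`, `tokens x l` produces
the pairs of the value of `x` with the elements of `l`, and `read x d P` branches on the cell of the
input tape whose number is `d` plus the value of `x`. -/
inductive Scheme (α ι T : Type) : Type
  | tokens (x : ι) (l : List T)
  | append (P Q : Scheme α ι T)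
  | loop (x : ι) (P : Scheme α ι T)
  | read (x : ι) (d : ℕ) (P : InSym α → Scheme α ι T)

namespace Scheme

variable {α β ι T : Type} [DecidableEq ι]

/-- The word produced by a scheme with bound `S` and values `ρ` of the variables. -/
def eval (S : ℕ) (w : List α) : Scheme α ι T → (ι → ℕ) → List (ℕ × T)
  | tokens x l, ρ => l.map fun t => (ρ x, t)
  | append P Q, ρ => P.eval S w ρ ++ Q.eval S w ρ
  | loop x P, ρ => (List.range S).flatMap fun j => P.eval S w (Function.update ρ x j)
  | read x d P, ρ => (P (Transducer.readInput w (d + ρ x))).eval S w ρ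

/-- No loop runs over a variable from `U` or over the variable of a surrounding loop. -/
def Scoped : Set ι → Scheme α ι T → Prop
  | _, tokens _ _ => True
  | U, append P Q => P.Scoped U ∧ Q.Scoped U
  | U, loop x P => x ∉ U ∧ P.Scoped (insert x U)
  | U, read _ _ P => ∀ a, (P a).Scoped U

/-- The word in which every `none` is replaced by the word `u ^ k`. -/
def expand (u : β) (k : ℕ) (l : List (Option β)) : List β :=
  l.flatMap fun b => b.elim (List.replicate k u) fun b => [b]

/-- The word over `β` given by a word over `ℕ × T`, where the token `t` stands for `τ t` and `none`
in it for as many letters `u` as the index of the token. -/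
def write (u : β) (τ : T → List (Option β)) (l : List (ℕ × T)) : List β :=
  l.flatMap fun p => expand u p.1 (τ p.2)

theorem write_append (u : β) (τ : T → List (Option β)) (l l' : List (ℕ × T)) :
    write u τ (l ++ l') = write u τ l ++ write u τ l' :=
  List.flatMap_append

theorem lt_of_mem_eval {S : ℕ} {w : List α} {P : Scheme α ι T} {ρ : ι → ℕ} (hρ : ∀ x, ρ x < S)
    {p : ℕ × T} (hp : p ∈ P.eval S w ρ) : p.1 < S := by
  induction P generalizing ρ with
  | tokens x l =>
    obtain ⟨t, _, rfl⟩ := List.mem_map.1 hp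
    exact hρ x
  | append P Q ihP ihQ => exact (List.mem_append.1 hp).elim (ihP hρ) (ihQ hρ)
  | loop x P ih =>
    obtain ⟨j, hj, hp⟩ := List.mem_flatMap.1 hp
    exact ih ((Function.forall_update_iff ρ fun _ n => n < S).2
      ⟨List.mem_range.1 hj, fun y _ => hρ y⟩) hp
  | read x d P ih => exact ih _ hρ hp

end Scheme

namespace Fragment

variable {α β κ ι T : Type} [DecidableEq κ] {w : List α} {H : ℕ}

/-- Output the letters `l`, and instead of each `none` as many letters `u` as the value of `c`. -/
def emitTemplate (a c : κ) (u : β) : List (Option β) → Fragment α β κ Unit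
  | [] => skip ()
  | none :: l => seq (forLoop a c (emit u)) (emitTemplate a c u l)
  | some b :: l => seq (emit b) (emitTemplate a c u l)

theorem does_emitTemplate {a c : κ} (hac : a ≠ c) {v : κ → ℕ} (ha : v a = 0) (hc : v c < 2 ^ H)
    (u : β) (l : List (Option β)) (i : ℕ) :
    (emitTemplate a c u l).Does w H v i () v i (Scheme.expand u (v c) l) := by
  induction l with
  | nil => exact does_skip () v i
  | cons b l ih =>
    cases b with
    | none =>
      have hloop := does_forLoop_const (w := w) (i := i) hac ha hc
        fun t _ => does_emit u (Function.update v a t) i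
      rw [← List.map_eq_flatMap, List.map_const', List.length_range] at hloop
      exact hloop.seq ih
    | some b => exact (does_emit b v i).seq ih

/-- From the left end marker, go to the cell whose number is `d` plus the value of `c`, branch on
the symbol there, and go back. -/
def branchAt [Finite α] (a c : κ) (d : ℕ) (G : InSym α → Fragment α β κ Unit) :
    Fragment α β κ Unit :=
  seq (repeatN moveRight d) (seq (forLoop a c moveRight)
    (bind (single id .stay none) fun y => seq rewind (G y)))

theorem does_branchAt [Finite α] {a c : κ} (hac : a ≠ c) {v v' : κ → ℕ} (ha : v a = 0)
    (hc : v c < 2 ^ H) {d : ℕ} {G : InSym α → Fragment α β κ Unit} {o : List β}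
    (hG : (G (Transducer.readInput w (d + v c))).Does w H v 0 () v' 0 o) :
    (branchAt a c d G).Does w H v 0 () v' 0 o := by
  have hconst := does_repeatN (β := β) (w := w) (H := H) (F := moveRight) (V := fun _ => v)
    (I := fun t => min t (w.length + 1)) d fun t _ => does_moveRight v t
  have hvar := does_forLoop (β := β) (w := w) (H := H) (F := moveRight) hac (V := fun _ => v)
    (I := fun t => min (d + t) (w.length + 1)) (o := fun _ => []) (n := v c) (fun _ => ha)
    (fun _ => rfl) hc fun t _ => does_moveRight _ (d + t)
  have hnil : (List.range (v c)).flatMap (fun _ => ([] : List β)) = [] := by simp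
  rw [hnil] at hvar
  rw [← readInput_min] at hG
  exact hconst.seq (o' := o) (hvar.seq (o' := o) (Does.bind (o' := o)
    (does_single_stay id none v _) ((does_rewind v _).seq hG)))

/-- Add the number `(|w| + 1 + C) ^ l.length` to the counter `c`, where `w` is the input word,
by loops over the counters `l`. The base of the power is computed in the counter `d`. -/
def addInputPow (c d : κ) (l : List κ) (C : ℕ) : Fragment α β κ Unit :=
  seq (countInput d) (seq (repeatN (inc d) C) (addPow c d l))

theorem does_addInputPow {c d : κ} {l : List κ} (hl : (d :: c :: l).Nodup) (hl₀ : l.length ≠ 0)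
    {C : ℕ} (hlt : (w.length + 1 + C) ^ l.length < 2 ^ H) :
    (addInputPow (β := β) c d l C).Does w H 0 0 ()
      (Function.update (Function.update 0 d (w.length + 1 + C)) c
        ((w.length + 1 + C) ^ l.length)) 0 [] := by
  have hbase : w.length + 1 + C < 2 ^ H := (Nat.le_self_pow hl₀ _).trans_lt hlt
  have hcount := does_countInput (β := β) (w := w) (H := H) (c := d) (v := 0)
    (by simp only [Pi.zero_apply]; omega)
  let V (t : ℕ) : κ → ℕ := Function.update 0 d (w.length + 1 + t)
  have hshift := does_repeatN (β := β) (w := w) (H := H) (F := inc d) (V := V) (I := fun _ => 0) C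
    fun t ht => by
      have := does_inc (α := α) (β := β) (w := w) (c := d) (v := V t) (H := H)
        (by simp only [V, Function.update_self]; omega) 0
      simpa [V, add_assoc] using this
  have hcd : c ≠ d := by rintro rfl; simp at hl
  have hpow := does_addPow (α := α) (β := β) (w := w) (v := V C) (H := H) hl
    (fun a ha => by
      have : a ≠ d := by rintro rfl; simp [ha] at hl
      simp [V, this])
    (by simpa [V] using hbase) (by simpa [V, hcd] using hlt) 0
  have := hcount.seq (o' := []) ((by simpa [V] using hshift :
    (repeatN (β := β) (inc d) C).Does w H (Function.update 0 d (0 + w.length + 1)) 0 () (V C) 0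
      []).seq hpow)
  simpa [addInputPow, V, hcd] using this

/-- The fragment of a scheme. The variables of the scheme are held by the counters `c`, the bound by
the counter `s`, and the counter `a` is used for auxiliary loops. -/
def ofScheme [Finite α] (a s : κ) (c : ι → κ) (u : β) (τ : T → List (Option β)) :
    Scheme α ι T → Fragment α β κ Unit
  | .tokens x l => emitTemplate a (c x) u (l.flatMap τ)
  | .append P Q => seq (ofScheme a s c u τ P) (ofScheme a s c u τ Q)
  | .loop x P => forLoop (c x) s (ofScheme a s c u τ P)
  | .read x d P => branchAt a (c x) d fun y => ofScheme a s c u τ (P y)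

theorem does_ofScheme [Finite α] [DecidableEq ι] {a s : κ} {c : ι → κ} (hac : ∀ x, a ≠ c x)
    (hsc : ∀ x, s ≠ c x) (hc : Function.Injective c) (u : β)
    (τ : T → List (Option β)) (P : Scheme α ι T) {U : Set ι} (hP : P.Scoped U) {v : κ → ℕ}
    (ha : v a = 0) (hU : ∀ x ∉ U, v (c x) = 0) (hlt : ∀ x, v (c x) < 2 ^ H) (hs : v s < 2 ^ H) :
    (ofScheme a s c u τ P).Does w H v 0 () v 0 (Scheme.write u τ (P.eval (v s) w (v ∘ c))) := by
  induction P generalizing U v with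
  | tokens x l =>
    have hword : Scheme.write u τ (l.map fun t => (v (c x), t)) =
        Scheme.expand u (v (c x)) (l.flatMap τ) := by
      simp only [Scheme.write, Scheme.expand, List.flatMap_map, List.flatMap_assoc]
    exact hword ▸ does_emitTemplate (hac x) ha (hlt x) u (l.flatMap τ) 0
  | append P Q ihP ihQ =>
    rw [Scheme.eval, Scheme.write_append]
    exact (ihP hP.1 ha hU hlt hs).seq (ihQ hP.2 ha hU hlt hs)
  | loop x P ih =>
    rw [Scheme.eval, Scheme.write, List.flatMap_assoc]
    refine does_forLoop_const (hsc x).symm (hU x hP.1) hs fun t ht => ?_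
    have hbody := ih hP.2 (v := Function.update v (c x) t) (by simpa [hac x] using ha)
      (fun y hy => ?_) (fun y => ?_) (by simpa [hsc x] using hs)
    · rwa [Function.update_of_ne (hsc x), Function.update_comp_eq_of_injective _ hc] at hbody
    · have hyx := not_or.1 hy
      simpa [hc.ne hyx.1] using hU y hyx.2
    · by_cases hyx : y = x
      · simpa [hyx] using ht.trans hs
      · simpa [hc.ne hyx] using hlt y
  | read x d P ih => exact does_branchAt (hac x) ha (hlt x) (ih _ (hP _) ha hU hlt hs)

end Fragment

theorem logspaceComputable_of_does {α β κ : Type} [Finite κ] (F : Fragment α β κ Unit)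
    (f : List α → List β) (C : ℕ)
    (hF : ∀ w : List α, ∃ H v i, H + 2 ≤ C * (Nat.log 2 w.length + 1) ∧
      F.Does w H 0 0 () v i (f w)) : LogspaceComputable f := by
  let G : Fragment α β κ Unit := .seq .putMark F
  have hrun : ∀ w : List α, ∃ h m, h < C * (Nat.log 2 w.length + 1) ∧
      G.Run w h G.start ⟨0, 0, fun _ => none, []⟩ () m ∧ m.head ≤ h ∧ m.out = f w := by
    intro w
    obtain ⟨H, v, i, hH, hD⟩ := hF w
    obtain ⟨m, hr, hm, ho⟩ := hD ⟨0, 0, Fragment.tapeOf [], []⟩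
      ⟨rfl, Nat.zero_le _, rfl, [], Nat.zero_le _, rfl, columnValue_nil⟩
    have hmark : Function.update (fun _ : ℕ => (none : TapeSym κ)) 0 (some none) =
        Fragment.tapeOf ([] : List (κ → Bool)) := by
      funext j
      rcases j with _ | j <;> simp [Fragment.tapeOf]
    refine ⟨H + 1, m, hH, Fragment.Run.bind (e := ()) (.exit (Nat.zero_le _) ?_) hr,
      hm.2.2.1.trans_le (Nat.zero_le _), ho⟩
    simp [Fragment.step, Fragment.putMark, Move.apply, hmark]
  refine ⟨G.toTransducer, C, fun w => ?_, fun w c hc i => ?_⟩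
  · obtain ⟨h, m, -, hr, -, ho⟩ := hrun w
    exact ⟨_, hr.reaches_toTransducer, G.step_toTransducer_none w m, ho⟩
  · obtain ⟨h, m, hlt, hr, hm, -⟩ := hrun w
    exact (hr.heads_le_of_reaches hm hc i).trans_lt hlt

theorem add_pow_lt_two_pow_log (C n : ℕ) :
    (n + 1 + C) ^ (C + 1) < 2 ^ ((C + 1) * (C + 1 + Nat.log 2 n) + 1) := by
  have hn : n + 1 ≤ 2 ^ (Nat.log 2 n + 1) := Nat.lt_pow_succ_log_self one_lt_two n
  have hbase : n + 1 + C ≤ 2 ^ (C + 1 + Nat.log 2 n) := calc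
    n + 1 + C ≤ (n + 1) * (C + 1) := by nlinarith
    _ ≤ 2 ^ (Nat.log 2 n + 1) * 2 ^ C := Nat.mul_le_mul hn Nat.lt_two_pow_self
    _ = 2 ^ (C + 1 + Nat.log 2 n) := by ring
  calc (n + 1 + C) ^ (C + 1) ≤ (2 ^ (C + 1 + Nat.log 2 n)) ^ (C + 1) := Nat.pow_le_pow_left hbase _
    _ = 2 ^ ((C + 1) * (C + 1 + Nat.log 2 n)) := by rw [← pow_mul, mul_comm]
    _ < 2 ^ ((C + 1) * (C + 1 + Nat.log 2 n) + 1) :=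
      Nat.pow_lt_pow_right one_lt_two (Nat.lt_succ_self _)

theorem Scheme.logspaceComputable {α β ι T : Type} [Finite α] [Finite ι] [DecidableEq ι]
    (P : Scheme α ι T) (hP : P.Scoped ∅) (C : ℕ) (u : β) (τ : T → List (Option β))
    (suffix : List β) :
    LogspaceComputable fun w : List α =>
      Scheme.write u τ (P.eval ((w.length + 1 + C) ^ (C + 1)) w 0) ++ suffix := by
  let base : Bool ⊕ Fin (C + 1) ⊕ ι := .inl false
  let bound : Bool ⊕ Fin (C + 1) ⊕ ι := .inl true
  let aux (i : Fin (C + 1)) : Bool ⊕ Fin (C + 1) ⊕ ι := .inr (.inl i)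
  let var (x : ι) : Bool ⊕ Fin (C + 1) ⊕ ι := .inr (.inr x)
  let auxs := (List.finRange (C + 1)).map aux
  classical
  refine logspaceComputable_of_does (.seq (.addInputPow bound base auxs C)
    (.seq (.ofScheme (aux 0) bound var u τ P) (.emitWord suffix)))
    _ ((C + 1) * (C + 1) + 3) fun w => ?_
  have hlt := add_pow_lt_two_pow_log C w.length
  set H := (C + 1) * (C + 1 + Nat.log 2 w.length) + 1
  have hnodup : (base :: bound :: auxs).Nodup := by
    have : auxs.Nodup := (List.nodup_finRange _).map fun i j h => by simpa [aux] using h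
    simpa [base, bound, auxs, aux] using this
  have hlength : auxs.length = C + 1 := by simp [auxs]
  have hbound := Fragment.does_addInputPow (α := α) (β := β) (w := w) (H := H) (C := C) hnodup
    (by simp [hlength]) (by rwa [hlength])
  rw [hlength] at hbound
  set v : Bool ⊕ Fin (C + 1) ⊕ ι → ℕ := Function.update (Function.update 0 base
    (w.length + 1 + C)) bound ((w.length + 1 + C) ^ (C + 1)) with hv
  have hvar (x : ι) : v (var x) = 0 := by simp [hv, var, base, bound]
  have hscheme := Fragment.does_ofScheme (w := w) (H := H) (v := v) (a := aux 0) (s := bound)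
    (c := var) (by simp [aux, var]) (by simp [bound, var]) (fun x y h => by simpa [var] using h)
    u τ P hP (by simp [hv, aux, base, bound]) (fun x _ => hvar x) (by simp [hvar])
    (by simpa [hv] using hlt)
  have hcomp : v ∘ var = 0 := funext hvar
  rw [hcomp, show v bound = (w.length + 1 + C) ^ (C + 1) by simp [hv]] at hscheme
  exact ⟨H, v, 0, by simp only [H]; nlinarith [Nat.zero_le (C * (C + 1) * Nat.log 2 w.length)],
    hbound.seq (hscheme.seq (Fragment.does_emitWord suffix v 0))⟩

/-! ### Positive sentences as lists of instructions -/

open scoped FirstOrder in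
theorem Formula.Holds.map {σ : FirstOrder.Language.{0, 0}} {A B : Type*} [σ.Structure A]
    [σ.Structure B] (f : A →[σ] B) (hf : Function.Surjective f) {φ : Formula σ} {ε : ℕ → A}
    (h : φ.Holds ε) : φ.Holds (f ∘ ε) := by
  induction φ generalizing ε with
  | rel R v => exact f.map_rel R _ h
  | and φ ψ ih ih' => exact ⟨ih h.1, ih' h.2⟩
  | or φ ψ ih ih' => exact h.imp ih ih'
  | ex x φ ih =>
    obtain ⟨a, h⟩ := h
    exact ⟨f a, by rw [← Function.comp_update]; exact ih h⟩
  | all x φ ih =>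
    intro b
    obtain ⟨a, rfl⟩ := hf b
    rw [← Function.comp_update]
    exact ih (h a)

open scoped FirstOrder in
theorem Formula.TrueIn.map {σ : FirstOrder.Language.{0, 0}} {A B : Type*} [σ.Structure A]
    [σ.Structure B] (f : A →[σ] B) (hf : Function.Surjective f) {φ : Formula σ}
    (h : φ.TrueIn A) : φ.TrueIn B := by
  intro ε
  have := (h (Function.surjInv hf ∘ ε)).map f hf
  rwa [← Function.comp_assoc, (Function.rightInverse_surjInv hf).comp_eq_id] at this

theorem Formula.TrueIn.of_surjective {A B : Type*} {f : A → B} (hf : Function.Surjective f)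
    {φ : Formula eqLang} (h : φ.TrueIn A) : φ.TrueIn B := by
  let F : FirstOrder.Language.Hom eqLang A B :=
    { toFun := f
      map_fun' := fun g => nomatch g
      map_rel' := fun
        | EqRel.eq, _, h => congrArg f h }
  exact h.map F hf

/-- Quantifier-free positive formulas in equality, with variables from `V`. -/
inductive QFFormula (V : Type) : Type
  | eq (x y : V)
  | and (φ ψ : QFFormula V)
  | or (φ ψ : QFFormula V)

namespace QFFormula

variable {V V' : Type}

/-- Satisfaction under an evaluation of the variables. -/
def Holds {A : Type*} : QFFormula V → (V → A) → Prop
  | eq x y, ρ => ρ x = ρ y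
  | and φ ψ, ρ => φ.Holds ρ ∧ ψ.Holds ρ
  | or φ ψ, ρ => φ.Holds ρ ∨ ψ.Holds ρ

/-- Renaming of the variables. -/
def map (f : V → V') : QFFormula V → QFFormula V'
  | eq x y => eq (f x) (f y)
  | and φ ψ => and (φ.map f) (ψ.map f)
  | or φ ψ => or (φ.map f) (ψ.map f)

/-- The variables that occur in a formula. -/
def vars : QFFormula V → Set V
  | eq x y => {x, y}
  | and φ ψ => φ.vars ∪ ψ.vars
  | or φ ψ => φ.vars ∪ ψ.vars

/-- The formula in which the variable `x` is numbered by `num x`. -/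
def toFormula (num : V → ℕ) : QFFormula V → Formula eqLang
  | eq x y => Formula.rel (n := 2) EqRel.eq ![num x, num y]
  | and φ ψ => Formula.and (φ.toFormula num) (ψ.toFormula num)
  | or φ ψ => Formula.or (φ.toFormula num) (ψ.toFormula num)

/-- The formula in prefix notation, in which the variable `x` is written as `t x`. -/
def word (t : V → List (Option (Letter eqLang))) : QFFormula V → List (Option (Letter eqLang))
  | eq x y => some (Letter.rel (n := 2) EqRel.eq) :: (t x ++ t y)
  | and φ ψ => some Letter.and :: (φ.word t ++ ψ.word t)
  | or φ ψ => some Letter.or :: (φ.word t ++ ψ.word t)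

theorem holds_map {A : Type*} (f : V → V') (ρ : V' → A) (φ : QFFormula V) :
    (φ.map f).Holds ρ ↔ φ.Holds (ρ ∘ f) := by
  induction φ with
  | eq x y => rfl
  | and φ ψ ih ih' => simp only [map, Holds, ih, ih']
  | or φ ψ ih ih' => simp only [map, Holds, ih, ih']

theorem vars_map (f : V → V') (φ : QFFormula V) : (φ.map f).vars = f '' φ.vars := by
  induction φ with
  | eq x y => simp only [map, vars, Set.image_pair]
  | and φ ψ ih ih' => simp only [map, vars, ih, ih', Set.image_union]
  | or φ ψ ih ih' => simp only [map, vars, ih, ih', Set.image_union]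

theorem holds_toFormula {A : Type*} (num : V → ℕ) (φ : QFFormula V) (ε : ℕ → A) :
    (φ.toFormula num).Holds ε ↔ φ.Holds (ε ∘ num) := by
  induction φ with
  | eq x y => rfl
  | and φ ψ ih ih' => simp only [toFormula, Formula.Holds, Holds, ih, ih']
  | or φ ψ ih ih' => simp only [toFormula, Formula.Holds, Holds, ih, ih']

theorem freeVars_toFormula (num : V → ℕ) (φ : QFFormula V) :
    (φ.toFormula num).freeVars = num '' φ.vars := by
  induction φ with
  | eq x y => simp [toFormula, vars, Formula.freeVars, Set.image_pair, Set.pair_comm]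
  | and φ ψ ih ih' => simp only [toFormula, vars, Formula.freeVars, ih, ih', Set.image_union]
  | or φ ψ ih ih' => simp only [toFormula, vars, Formula.freeVars, ih, ih', Set.image_union]

theorem expand_word {k : ℕ} {f : V → V'} {num : V' → ℕ} {t : V → List (Option (Letter eqLang))}
    (ht : ∀ x, Scheme.expand .stroke k (t x) = encodeVar (num (f x))) (φ : QFFormula V) :
    Scheme.expand .stroke k (φ.word t) = ((φ.map f).toFormula num).encode := by
  simp only [Scheme.expand] at ht ⊢
  induction φ with
  | eq x y => simp [word, map, toFormula, Formula.encode, ht]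
  | and φ ψ ih ih' => simp [word, map, toFormula, Formula.encode, ih, ih']
  | or φ ψ ih ih' => simp [word, map, toFormula, Formula.encode, ih, ih']

end QFFormula

/-- The pieces from which a sentence is built from left to right: a quantifier, or a formula that is
joined to the rest by `∧` (`assert`) or by `∨` (`alt`). -/
inductive Instr (V : Type) : Type
  | ex (x : V)
  | all (x : V)
  | assert (φ : QFFormula V)
  | alt (φ : QFFormula V)

namespace Instr

variable {V V' : Type}

/-- Renaming of the variables. -/
def map (f : V → V') : Instr V → Instr V'
  | ex x => ex (f x)
  | all x => all (f x)
  | assert φ => assert (φ.map f)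
  | alt φ => alt (φ.map f)

/-- The variables that occur in an instruction. -/
def vars : Instr V → Set V
  | ex x => {x}
  | all x => {x}
  | assert φ => φ.vars
  | alt φ => φ.vars

/-- The instruction as the beginning of a formula in prefix notation, in which the variable `x` is
written as `t x`. -/
def word (t : V → List (Option (Letter eqLang))) : Instr V → List (Option (Letter eqLang))
  | ex x => some Letter.ex :: t x
  | all x => some Letter.all :: t x
  | assert φ => some Letter.and :: φ.word t
  | alt φ => some Letter.or :: φ.word t

open scoped Classical in
/-- Satisfaction of the formula given by a list of instructions. -/
noncomputable def Holds {A : Type*} : List (Instr V) → (V → A) → Prop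
  | [], _ => True
  | ex x :: I, ρ => ∃ a, Holds I (Function.update ρ x a)
  | all x :: I, ρ => ∀ a, Holds I (Function.update ρ x a)
  | assert φ :: I, ρ => φ.Holds ρ ∧ Holds I ρ
  | alt φ :: I, ρ => φ.Holds ρ ∨ Holds I ρ

/-- The formula given by a list of instructions. It ends with the true formula `v = v`. -/
def toFormula (num : V → ℕ) (v : V) : List (Instr V) → Formula eqLang
  | [] => (QFFormula.eq v v).toFormula num
  | ex x :: I => Formula.ex (num x) (toFormula num v I)
  | all x :: I => Formula.all (num x) (toFormula num v I)
  | assert φ :: I => Formula.and (φ.toFormula num) (toFormula num v I)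
  | alt φ :: I => Formula.or (φ.toFormula num) (toFormula num v I)

theorem vars_map (f : V → V') (i : Instr V) : (i.map f).vars = f '' i.vars := by
  cases i <;> simp [map, vars, QFFormula.vars_map]

theorem holds_toFormula {A : Type*} {num : V → ℕ} (hnum : Function.Injective num) (v : V)
    (I : List (Instr V)) (ε : ℕ → A) : (toFormula num v I).Holds ε ↔ Holds I (ε ∘ num) := by
  classical
  induction I generalizing ε with
  | nil => exact iff_of_true rfl trivial
  | cons i I ih =>
    cases i with
    | ex x =>
      simp only [toFormula, Formula.Holds, Holds, ih, Function.update_comp_eq_of_injective _ hnum]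
    | all x =>
      simp only [toFormula, Formula.Holds, Holds, ih, Function.update_comp_eq_of_injective _ hnum]
    | assert φ => simp only [toFormula, Formula.Holds, Holds, ih, QFFormula.holds_toFormula]
    | alt φ => simp only [toFormula, Formula.Holds, Holds, ih, QFFormula.holds_toFormula]

theorem encode_toFormula {f : ℕ → V → V'} {num : V' → ℕ} {t : V → List (Option (Letter eqLang))}
    (ht : ∀ k x, Scheme.expand .stroke k (t x) = encodeVar (num (f k x))) (v : V')
    (l : List (ℕ × Instr V)) : (toFormula num v (l.map fun p => p.2.map (f p.1))).encode =
      Scheme.write .stroke (word t) l ++ ((QFFormula.eq v v).toFormula num).encode := by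
  induction l with
  | nil => rfl
  | cons p l ih =>
    obtain ⟨k, i⟩ := p
    have hi (I : List (Instr V')) : (toFormula num v (i.map (f k) :: I)).encode =
        Scheme.expand .stroke k (word t i) ++ (toFormula num v I).encode := by
      have hword := QFFormula.expand_word (ht k)
      have hk := ht k
      simp only [Scheme.expand] at hword hk ⊢
      cases i <;> simp [map, toFormula, Formula.encode, word, hword, hk]
    simp only [List.map_cons, hi, ih, Scheme.write, List.flatMap_cons, List.append_assoc]

theorem freeVars_toFormula_subset {num : V → ℕ} {v : V} {s : Set V} (hv : v ∈ s)
    {I : List (Instr V)} (hI : ∀ i ∈ I, i.vars ⊆ s) : (toFormula num v I).freeVars ⊆ num '' s := by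
  induction I with
  | nil =>
    rw [toFormula, QFFormula.freeVars_toFormula]
    exact Set.image_mono (Set.pair_subset hv hv)
  | cons i I ih =>
    obtain ⟨hi, hI'⟩ := List.forall_mem_cons.1 hI
    have hφ {φ : QFFormula V} (h : φ.vars ⊆ s) : (φ.toFormula num).freeVars ⊆ num '' s := by
      rw [QFFormula.freeVars_toFormula]
      exact Set.image_mono h
    cases i with
    | ex x => exact Set.sdiff_subset.trans (ih hI')
    | all x => exact Set.sdiff_subset.trans (ih hI')
    | assert φ => exact Set.union_subset (hφ hi) (ih hI')
    | alt φ => exact Set.union_subset (hφ hi) (ih hI')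

theorem freeVars_toFormula_exs (num : V → ℕ) (v : V) (l : List V) (I : List (Instr V)) :
    (toFormula num v (l.map ex ++ I)).freeVars =
      (toFormula num v I).freeVars \ num '' {x | x ∈ l} := by
  induction l with
  | nil => simp
  | cons x l ih =>
    have hcons : {y | y ∈ x :: l} = insert x {y | y ∈ l} := by ext; simp
    rw [hcons, Set.image_insert_eq, ← Set.union_singleton, ← Set.sdiff_sdiff, ← ih]
    rfl

/-- The beginning of a sentence: either `x = y`, or there are values of the variables `l` such that
the rest holds. -/
def opening (x y : V) (l : List V) : List (Instr V) :=
  all x :: all y :: alt (.eq x y) :: l.map ex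

theorem isSentence_toFormula_opening (num : V → ℕ) (x y : V) {l : List V} {I : List (Instr V)}
    (hI : ∀ i ∈ I, i.vars ⊆ {x, y} ∪ {z | z ∈ l}) :
    (toFormula num x (opening x y l ++ I)).IsSentence := by
  have hfree := freeVars_toFormula_subset (num := num) (v := x) (by simp) hI
  rw [Set.image_union] at hfree
  have hpair : ((QFFormula.eq x y).toFormula num).freeVars = {num x, num y} := by
    rw [QFFormula.freeVars_toFormula, QFFormula.vars, Set.image_pair]
  have hsub : (toFormula num x (l.map ex ++ I)).freeVars ⊆ {num x, num y} := by
    rw [freeVars_toFormula_exs, Set.sdiff_subset_iff, Set.union_comm, ← Set.image_pair]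
    exact hfree
  rw [Formula.IsSentence, Set.eq_empty_iff_forall_notMem]
  rintro k ⟨⟨hk, hky⟩, hkx⟩
  have hmem : k ∈ ({num x, num y} : Set ℕ) := hk.elim (hpair ▸ ·) (hsub ·)
  exact hmem.elim hkx hky

theorem holds_exs {A : Type*} (l : List V) (I : List (Instr V)) (ρ : V → A) :
    Holds (l.map ex ++ I) ρ ↔ ∃ ρ' : V → A, (∀ x ∉ l, ρ' x = ρ x) ∧ Holds I ρ' := by
  classical
  induction l generalizing ρ with
  | nil => exact ⟨fun h => ⟨ρ, fun _ _ => rfl, h⟩, fun ⟨ρ', h, h'⟩ =>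
      funext (fun x => h x List.not_mem_nil) ▸ h'⟩
  | cons y l ih =>
    simp only [List.map_cons, List.cons_append, Holds, ih, List.mem_cons, not_or]
    constructor
    · rintro ⟨a, ρ', h, h'⟩
      exact ⟨ρ', fun x hx => by rw [h x hx.2, Function.update_of_ne hx.1], h'⟩
    · rintro ⟨ρ', h, h'⟩
      refine ⟨ρ' y, ρ', fun x hx => ?_, h'⟩
      by_cases hxy : x = y
      · rw [hxy, Function.update_self]
      · rw [Function.update_of_ne hxy, h x ⟨hxy, hx⟩]

theorem holds_flatMap {ι A : Type*} {g : ι → List (Instr V)} {ρ : V → A} {p : ι → Prop}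
    (hg : ∀ i I, Holds (g i ++ I) ρ ↔ p i ∧ Holds I ρ) (l : List ι) (I : List (Instr V)) :
    Holds (l.flatMap g ++ I) ρ ↔ (∀ i ∈ l, p i) ∧ Holds I ρ := by
  induction l with
  | nil => simp
  | cons i l ih => simp [hg, ih, and_assoc]

end Instr

/-! ### Sentences written by schemes -/

section Templates

variable {G F : Type}

/-- Local variables of a sentence are numbered by an index and an element of `F`. A template uses
the variables of three consecutive indices, and its instance at `j` begins with the index `j`. -/
def instVar (j : ℕ) : G ⊕ Fin 3 × F → G ⊕ ℕ × F :=
  Sum.map id (Prod.map (fun i => j + i) id)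

/-- The instructions of a scheme that writes templates. -/
def Scheme.instrs {α ι : Type} [DecidableEq ι] (S : ℕ) (w : List α)
    (P : Scheme α ι (Instr (G ⊕ Fin 3 × F))) (ρ : ι → ℕ) : List (Instr (G ⊕ ℕ × F)) :=
  (P.eval S w ρ).map fun p => p.2.map (instVar p.1)

variable [Finite G] [Finite F]

/-- An injective numbering of the variables that is affine in the index of the local variables. -/
noncomputable def varNum : G ⊕ ℕ × F → ℕ
  | .inl g => Finite.equivFin G g
  | .inr (j, f) => Nat.card G + (Finite.equivFin F f + Nat.card F * j)

theorem varNum_injective : Function.Injective (varNum (G := G) (F := F)) := by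
  rintro (g | ⟨j, f⟩) (g' | ⟨j', f'⟩) h <;> simp only [varNum] at h
  · rw [(Finite.equivFin G).injective (Fin.ext h)]
  · omega
  · omega
  · have hf := (Finite.equivFin F f).2
    have hf' := (Finite.equivFin F f').2
    have hpos : 0 < Nat.card F := by omega
    have h := Nat.add_left_cancel h
    have hj : j = j' := by
      simpa only [Nat.add_mul_div_left _ _ hpos, Nat.div_eq_of_lt hf, Nat.div_eq_of_lt hf',
        zero_add] using congrArg (· / Nat.card F) h
    rw [hj] at h
    rw [hj, (Finite.equivFin F).injective (Fin.ext (Nat.add_right_cancel h))]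

/-- The number of a variable of a template, where `none` stands for as many strokes as the index of
the instance. -/
noncomputable def templateVarWord : G ⊕ Fin 3 × F → List (Option (Letter eqLang))
  | .inl g => (encodeVar (Finite.equivFin G g)).map some
  | .inr (i, f) => List.replicate (Nat.card F) none ++
      (encodeVar (Nat.card G + (Finite.equivFin F f + Nat.card F * i))).map some

theorem expand_templateVarWord (j : ℕ) (x : G ⊕ Fin 3 × F) :
    Scheme.expand .stroke j (templateVarWord x) = encodeVar (varNum (instVar j x)) := by
  rcases x with g | ⟨i, f⟩
  · simp [Scheme.expand, templateVarWord, List.flatMap_map, instVar, varNum]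
  · have hstrokes : (List.replicate (Nat.card F) (none : Option (Letter eqLang))).flatMap
        (fun b => b.elim (List.replicate j .stroke) fun b => [b]) =
          List.replicate (Nat.card F * j) .stroke := by
      simp [List.flatMap_replicate]
    rw [Scheme.expand, templateVarWord, List.flatMap_append, hstrokes, List.flatMap_map]
    simp only [Option.elim_some, List.flatMap_singleton', instVar, Sum.map_inr, Prod.map, varNum,
      encodeVar, id, ← List.append_assoc, ← List.replicate_add]
    congr 2
    ring

theorem logspaceComputable_encode_toFormula {α ι : Type} [Finite α] [Finite ι] [DecidableEq ι]
    {P : Scheme α ι (Instr (G ⊕ Fin 3 × F))} (hP : P.Scoped ∅) (C : ℕ) (g : G) :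
    LogspaceComputable fun w : List α => (Instr.toFormula varNum (.inl g)
      (P.instrs ((w.length + 1 + C) ^ (C + 1)) w 0)).encode := by
  simp only [Scheme.instrs, Instr.encode_toFormula expand_templateVarWord]
  exact P.logspaceComputable hP C _ _ _

end Templates

/-! ### Turing machines as cellular automata -/

theorem iterate_eq_of_isFixedPt_of_card_le {X Y : Type*} [Finite Y] {f : X → X} {c : X} (g : X → Y)
    (hg : ∀ i j, g (f^[i] c) = g (f^[j] c) → f^[i] c = f^[j] c) {t N : ℕ}
    (ht : Function.IsFixedPt f (f^[t] c)) (hN : Nat.card Y ≤ N) : f^[N] c = f^[t] c := by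
  have hfixed {k : ℕ} (hk : t ≤ k) : f^[k] c = f^[t] c := by
    rw [← Nat.sub_add_cancel hk, Function.iterate_add_apply]
    exact ht.iterate _
  obtain ⟨i, j, hij, hjN, heq⟩ : ∃ i j, i < j ∧ j ≤ N ∧ f^[i] c = f^[j] c := by
    have : ¬Function.Injective fun i : Fin (N + 1) => g (f^[i] c) := fun h => by
      have := Nat.card_le_card_of_injective _ h
      rw [Nat.card_fin] at this
      omega
    obtain ⟨i, j, heq, hne⟩ := Function.not_injective_iff.1 this
    rcases lt_or_gt_of_ne hne with hij | hij
    · exact ⟨i, j, hij, by omega, hg i j heq⟩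
    · exact ⟨j, i, hij, by omega, (hg i j heq).symm⟩
  have hperiodic : Function.IsPeriodicPt f (j - i) (f^[i] c) := by
    rw [Function.IsPeriodicPt, Function.IsFixedPt, ← Function.iterate_add_apply,
      Nat.sub_add_cancel hij.le, heq]
  have hi : f^[i] c = f^[t] c := by
    rw [← hperiodic.const_mul t, ← Function.iterate_add_apply]
    exact hfixed (Nat.le_add_right_of_le (Nat.le_mul_of_pos_right t (Nat.sub_pos_of_lt hij)))
  rw [← Nat.sub_add_cancel (hij.le.trans hjN), Function.iterate_add_apply, hi]
  exact ht.iterate _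

/-- One step of the cellular automaton with local rule `f` on the cells `1, …, S`. All other cells
keep their contents. -/
def automaton {K : Type*} (f : K → K → K → K) (S : ℕ) (x : ℕ → K) (j : ℕ) : K :=
  if 1 ≤ j ∧ j ≤ S then f (x (j - 1)) (x j) (x (j + 1)) else x j

theorem iterate_automaton_of_notMem {K : Type*} (f : K → K → K → K) {S : ℕ} (n : ℕ) (x : ℕ → K)
    {j : ℕ} (hj : j ∉ Set.Icc 1 S) : (automaton f S)^[n] x j = x j := by
  induction n with
  | zero => rfl
  | succ n ih =>
    rw [Function.iterate_succ_apply', automaton]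
    exact (if_neg hj).trans ih

namespace TM

variable {α : Type} (M : TM α)

/-- The state, symbol and move that `M` chooses, where a halted machine repeats its
configuration. -/
def act (q : M.Q) (g : M.Γ) : M.Q × M.Γ × Move := (M.δ q g).getD (q, g, .stay)

/-- One step, where halted configurations are repeated. -/
def next (c : M.Cfg) : M.Cfg where
  state := (M.act c.state (c.tape c.head)).1
  head := (M.act c.state (c.tape c.head)).2.2.apply c.head
  tape := Function.update c.tape c.head (M.act c.state (c.tape c.head)).2.1

theorem next_eq_getD_step (c : M.Cfg) : M.next c = (M.step c).getD c := by
  rw [next, step, act]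
  cases M.δ c.state (c.tape c.head) with
  | none => simp [Move.apply]
  | some r => rfl

theorem isFixedPt_next {c : M.Cfg} (h : M.step c = none) : Function.IsFixedPt M.next c := by
  rw [Function.IsFixedPt, next_eq_getD_step, h, Option.getD_none]

theorem exists_iterate_next_eq {c c' : M.Cfg} (h : StateTransition.Reaches M.step c c') :
    ∃ t, M.next^[t] c = c' := by
  induction h with
  | refl => exact ⟨0, rfl⟩
  | tail _ hstep ih =>
    obtain ⟨t, rfl⟩ := ih
    exact ⟨t + 1, by rw [Function.iterate_succ_apply', next_eq_getD_step, Option.mem_def.1 hstep,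
      Option.getD_some]⟩

theorem reaches_iterate_next (c : M.Cfg) (t : ℕ) :
    StateTransition.Reaches M.step c (M.next^[t] c) := by
  induction t with
  | zero => exact Relation.ReflTransGen.refl
  | succ t ih =>
    rw [Function.iterate_succ_apply', next_eq_getD_step]
    cases h : M.step (M.next^[t] c) with
    | none => exact ih
    | some c' => exact ih.tail h

theorem tape_iterate_next {c : M.Cfg} {s : ℕ} (hs : ∀ t, (M.next^[t] c).head < s) (t : ℕ) {j : ℕ}
    (hj : s ≤ j) : (M.next^[t] c).tape j = c.tape j := by
  induction t with
  | zero => rfl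
  | succ t ih =>
    rw [Function.iterate_succ_apply', ← ih]
    exact Function.update_of_ne ((hs t).trans_le hj).ne' _ _

open scoped Classical in
/-- The symbol on the tape cell `j` and, if the head is on this cell, the state. -/
noncomputable def content (c : M.Cfg) (j : ℕ) : M.Γ × Option M.Q :=
  (c.tape j, if c.head = j then some c.state else none)

theorem content_injective : Function.Injective M.content := by
  intro c c' h
  have hhead : c'.head = c.head ∧ c.state = c'.state := by
    have := congrArg Prod.snd (congrFun h c.head)
    simp only [content, if_true] at this
    split_ifs at this with hhead
    exact ⟨hhead, Option.some.inj this⟩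
  have htape : c.tape = c'.tape := funext fun j => congrArg Prod.fst (congrFun h j)
  cases c
  cases c'
  simp_all

theorem iterate_next_eq_of_space {c : M.Cfg} {s N : ℕ} (hs : ∀ t, (M.next^[t] c).head < s)
    (hN : Nat.card (M.Γ × Option M.Q) ^ s ≤ N) {t : ℕ} (ht : M.step (M.next^[t] c) = none) :
    M.next^[N] c = M.next^[t] c := by
  have := M.finQ
  have := M.finΓ
  refine iterate_eq_of_isFixedPt_of_card_le (fun c (j : Fin s) => M.content c j) (fun i j hij => ?_)
    (M.isFixedPt_next ht) ?_
  · refine M.content_injective (funext fun k => ?_)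
    rcases lt_or_ge k s with hk | hk
    · exact congrFun hij ⟨k, hk⟩
    · simp only [content, M.tape_iterate_next hs _ hk, ((hs i).trans_le hk).ne,
        ((hs j).trans_le hk).ne, if_false]
  · rwa [Nat.card_fun, Nat.card_fin]

/-- The contents of a cell of the automaton that simulates `M`, where `none` marks the border to the
left of the tape. -/
abbrev Cell := Option (M.Γ × Option M.Q)

/-- A configuration as an array of cells. The border takes the cell `0`, so the tape is shifted by
one. -/
noncomputable def cells (c : M.Cfg) : ℕ → M.Cell
  | 0 => none
  | j + 1 => some (M.content c j)

open scoped Classical in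
/-- The new state of a head that scans the given cell, if it moves in the direction `d`. -/
noncomputable def sends (d : Move) : M.Cell → Option M.Q
  | some (g, some q) => if (M.act q g).2.2 = d then some (M.act q g).1 else none
  | _ => none

open scoped Classical in
/-- The contents of the cell `x` with neighbours `l` and `r` after a step. A head on the leftmost
cell of the tape stays there when it moves to the left. -/
noncomputable def localRule (l x r : M.Cell) : M.Cell :=
  x.map fun p => (p.2.elim p.1 fun q => (M.act q p.1).2.1,
    (((M.sends .stay x).or (M.sends .right l)).or (M.sends .left r)).or
      (if l = none then M.sends .left x else none))

open scoped Classical in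
theorem sends_cells_succ (d : Move) (c : M.Cfg) (j : ℕ) : M.sends d (M.cells c (j + 1)) =
    if c.head = j ∧ (M.act c.state (c.tape c.head)).2.2 = d then
      some (M.act c.state (c.tape c.head)).1 else none := by
  by_cases h : c.head = j
  · subst h
    simp [cells, content, sends]
  · simp [cells, content, sends, h]

open scoped Classical in
theorem localRule_cells (c : M.Cfg) (j : ℕ) :
    M.localRule (M.cells c j) (M.cells c (j + 1)) (M.cells c (j + 2)) =
      M.cells (M.next c) (j + 1) := by
  have hsymbol : (M.content c j).2.elim (M.content c j).1
      (fun q => (M.act q (M.content c j).1).2.1) = (M.next c).tape j := by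
    by_cases h : c.head = j
    · subst h
      simp [content, next]
    · simp [content, next, h, Function.update_of_ne (Ne.symm h)]
  have hstate : (((M.sends .stay (M.cells c (j + 1))).or (M.sends .right (M.cells c j))).or
      (M.sends .left (M.cells c (j + 2)))).or
        (if M.cells c j = none then M.sends .left (M.cells c (j + 1)) else none) =
      if (M.next c).head = j then some (M.next c).state else none := by
    have hhead : (M.next c).head = (M.act c.state (c.tape c.head)).2.2.apply c.head := rfl
    rw [hhead, sends_cells_succ, sends_cells_succ, sends_cells_succ, next]
    cases j with
    | zero =>
      have hborder : M.sends .right (M.cells c 0) = none := rfl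
      rw [hborder]
      generalize (M.act c.state (c.tape c.head)).2.2 = d
      cases d <;> grind [Move.apply, cells]
    | succ j =>
      rw [sends_cells_succ]
      generalize (M.act c.state (c.tape c.head)).2.2 = d
      cases d <;> grind [Move.apply, cells]
  exact congrArg some (Prod.ext hsymbol hstate)

theorem automaton_cells {c : M.Cfg} {S : ℕ} (h : c.head < S) (h' : (M.next c).head < S) :
    automaton M.localRule S (M.cells c) = M.cells (M.next c) := by
  funext j
  cases j with
  | zero => rfl
  | succ j =>
    rw [automaton]
    split_ifs with hj
    · exact M.localRule_cells c j
    · have hj : S ≤ j := by omega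
      have htape : (M.next c).tape j = c.tape j := Function.update_of_ne (h.trans_le hj).ne' _ _
      simp only [cells, content, htape, (h.trans_le hj).ne, (h'.trans_le hj).ne, if_false]

theorem iterate_automaton_cells {c : M.Cfg} {S : ℕ} (h : ∀ t, (M.next^[t] c).head < S) (t : ℕ) :
    (automaton M.localRule S)^[t] (M.cells c) = M.cells (M.next^[t] c) := by
  induction t with
  | zero => rfl
  | succ t ih =>
    have hnext := h (t + 1)
    rw [Function.iterate_succ_apply'] at hnext ⊢
    rw [ih, automaton_cells M (h t) hnext, ← Function.iterate_succ_apply' M.next]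

/-- The contents of a cell that do not show that the state is rejecting. -/
def nonRejecting : Set M.Cell := {x | ∀ g q, x = some (g, some q) → q ∈ M.accept}

theorem state_mem_accept_iff {c : M.Cfg} {S : ℕ} (hS : c.head < S) :
    c.state ∈ M.accept ↔ ∀ j ∈ Set.Icc 1 S, M.cells c j ∈ M.nonRejecting := by
  constructor
  · intro hc j _ g q hj
    cases j with
    | zero => simp [cells] at hj
    | succ j =>
      simp only [cells, content] at hj
      grind
  · intro h
    exact h (c.head + 1) ⟨by omega, hS⟩ (c.tape c.head) c.state (by simp [cells, content])

theorem mem_iff_iterate_automaton_mem {L : _root_.Language α} (hL : M.Decides L) {s : ℕ → ℕ}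
    (hs : M.RunsInSpace s) {w : List α} {S N : ℕ} (hS : s w.length ≤ S)
    (hN : Nat.card (M.Γ × Option M.Q) ^ s w.length ≤ N) : w ∈ L ↔ ∀ j ∈ Set.Icc 1 S,
      (automaton M.localRule S)^[N] (M.cells (M.init w)) j ∈ M.nonRejecting := by
  obtain ⟨c, hreach, hhalt, hc⟩ := hL w
  obtain ⟨t, rfl⟩ := M.exists_iterate_next_eq hreach
  have hhead (t : ℕ) : (M.next^[t] (M.init w)).head < s w.length :=
    hs w _ (M.reaches_iterate_next _ t)
  have hheadS (t : ℕ) : (M.next^[t] (M.init w)).head < S := (hhead t).trans_le hS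
  rw [iterate_automaton_cells M hheadS, iterate_next_eq_of_space M hhead hN hhalt, ← hc,
    state_mem_accept_iff M (hheadS t)]

end TM

/-- The elements of a set in a finite type. -/
noncomputable def listOf {X : Type} [Finite X] (s : Set X) : List X :=
  s.toFinite.toFinset.toList

theorem mem_listOf {X : Type} [Finite X] {s : Set X} {x : X} : x ∈ listOf s ↔ x ∈ s := by
  simp [listOf]

namespace QFFormula

variable {V X : Type} [Finite X]

/-- The conjunction of a finite family of formulas and the true formula `v = v`. -/
noncomputable def conj (v : V) (φ : X → QFFormula V) : QFFormula V :=
  (listOf Set.univ).foldr (fun x => and (φ x)) (eq v v)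

/-- The disjunction of a finite family of formulas and the formula `a = b`. -/
noncomputable def disj (a b : V) (φ : X → QFFormula V) : QFFormula V :=
  (listOf Set.univ).foldr (fun x => or (φ x)) (eq a b)

theorem holds_conj {A : Type*} (v : V) (φ : X → QFFormula V) (ρ : V → A) :
    (conj v φ).Holds ρ ↔ ∀ x, (φ x).Holds ρ := by
  have hfoldr (l : List X) : (l.foldr (fun x => and (φ x)) (eq v v)).Holds ρ ↔
      ∀ x ∈ l, (φ x).Holds ρ := by
    induction l with
    | nil => simp [Holds]
    | cons x l ih => simp [Holds, ih]
  simp [conj, hfoldr, mem_listOf]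

theorem holds_disj {A : Type*} (a b : V) (φ : X → QFFormula V) (ρ : V → A) :
    (disj a b φ).Holds ρ ↔ (∃ x, (φ x).Holds ρ) ∨ ρ a = ρ b := by
  have hfoldr (l : List X) : (l.foldr (fun x => or (φ x)) (eq a b)).Holds ρ ↔
      (∃ x ∈ l, (φ x).Holds ρ) ∨ ρ a = ρ b := by
    induction l with
    | nil => simp [Holds]
    | cons x l ih => simp [Holds, ih, or_assoc]
  simp [disj, hfoldr, mem_listOf]

end QFFormula

theorem Instr.holds_opening {V : Type} {A : Type*} {x y : V} {l : List V} (hxy : x ≠ y)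
    (hx : x ∉ l) (hy : y ∉ l) (I : List (Instr V)) (ρ : V → A) :
    Holds (opening x y l ++ I) ρ ↔ ∀ a b, a = b ∨ ∃ ρ' : V → A, ρ' x = a ∧ ρ' y = b ∧
      (∀ z ∉ l, z ≠ x → z ≠ y → ρ' z = ρ z) ∧ Holds I ρ' := by
  classical
  simp only [opening, List.cons_append, Holds, QFFormula.Holds, holds_exs]
  refine forall₂_congr fun a b => ?_
  rw [Function.update_of_ne hxy, Function.update_self, Function.update_self]
  refine or_congr_right (exists_congr fun ρ' => ?_)
  rw [← and_assoc, ← and_assoc]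
  refine and_congr_left' ⟨fun h => ⟨⟨?_, ?_⟩, fun z hz hzx hzy => ?_⟩, fun h z hz => ?_⟩
  · rw [h x hx, Function.update_of_ne hxy, Function.update_self]
  · rw [h y hy, Function.update_self]
  · rw [h z hz, Function.update_of_ne hzy, Function.update_of_ne hzx]
  · obtain ⟨⟨rfl, rfl⟩, h⟩ := h
    rcases eq_or_ne z y with rfl | hzy
    · rw [Function.update_self]
    rcases eq_or_ne z x with rfl | hzx
    · rw [Function.update_of_ne hzy, Function.update_self]
    · rw [Function.update_of_ne hzy, Function.update_of_ne hzx, h z hz hzx hzy]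

section Instances

variable {G F : Type}

/-- The instances of a list of templates at the indices below `S`. -/
def instances (S : ℕ) (l : List (Instr (G ⊕ Fin 3 × F))) : List (Instr (G ⊕ ℕ × F)) :=
  (List.range S).flatMap fun j => l.map (Instr.map (instVar j))

theorem instances_exs (S : ℕ) (l : List (G ⊕ Fin 3 × F)) :
    instances S (l.map .ex) = ((List.range S).flatMap fun j => l.map (instVar j)).map .ex := by
  simp only [instances, List.map_flatMap, List.map_map]
  rfl

theorem holds_instances_assert {A : Type*} (S : ℕ) (φ : QFFormula (G ⊕ Fin 3 × F))
    (I : List (Instr (G ⊕ ℕ × F))) (ρ : G ⊕ ℕ × F → A) :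
    Instr.Holds (instances S [.assert φ] ++ I) ρ ↔
      (∀ j < S, φ.Holds (ρ ∘ instVar j)) ∧ Instr.Holds I ρ := by
  rw [instances, Instr.holds_flatMap (p := fun j => φ.Holds (ρ ∘ instVar j)) fun j I => ?_]
  · simp only [List.mem_range]
  · exact and_congr_left' (QFFormula.holds_map ..)

end Instances

/-! ### The halving game -/

/-- A set of names. It prescribes for each name whether the second half of a run is played after a
challenge with this name. -/
abbrev Labelling (E : Type) := E → Bool

/-- The arrays of cells of the halving game: the array in the middle of the current run (`none`),
and the arrays at the beginning and the end of the current run. The latter are stored twice, as the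
arrays of the next run are chosen while those of the current run are still needed. -/
abbrev Row := Option (Bool × Bool)

namespace Row

/-- The array in the middle of the run. -/
abbrev mid : Row := none

/-- The array at the beginning of the run, in the copy `c`. -/
abbrev source (c : Bool) : Row := some (c, false)

/-- The array at the end of the run, in the copy `c`. -/
abbrev target (c : Bool) : Row := some (c, true)

end Row

/-- The global variables: two variables for the truth values, the challenge (`none`), and the
names. -/
abbrev Global (E : Type) := Bool ⊕ Option E

/-- The variables at one index: for each row and labelling, and each content of a cell, the truth
value of the statement that the cell has this content. -/
abbrev Local (E K : Type) := Row × Labelling E × K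

/-- The variables of the halving game. -/
abbrev GVar (E K : Type) := Global E ⊕ ℕ × Local E K

/-- The variables of the templates for the halving game. -/
abbrev TVar (E K : Type) := Global E ⊕ Fin 3 × Local E K

namespace Global

variable {E : Type}

/-- The variable for a truth value. -/
abbrev cst (t : Bool) : Global E := .inl t

/-- The variable for the challenge of the universal player. -/
abbrev chal : Global E := .inr none

/-- The variable for the element with the given name. -/
abbrev name (e : E) : Global E := .inr (some e)

end Global

section HalvingGame

open Global Row

variable {E K : Type}

/-- The template of a cell variable. -/
abbrev cell (i : Fin 3) (k : Row) (W : Labelling E) (r : K) : TVar E K := .inr (i, k, W, r)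

/-- The variables of a cell. -/
def row {X : Type*} (ρ : GVar E K → X) (k : Row) (W : Labelling E) (j : ℕ) : K → X :=
  fun r => ρ (.inr (j, k, W, r))

open scoped Classical in
/-- The values `v` of the variables of a cell say that it has the content `σ`. -/
def Codes {X : Type*} (ρ : GVar E K → X) (v : K → X) (σ : K) : Prop :=
  ∀ r, v r = ρ (.inl (cst (decide (r = σ))))

theorem Codes.unique {X : Type*} {ρ : GVar E K → X} {v : K → X} {σ τ : K}
    (hρ : ρ (.inl (cst false)) ≠ ρ (.inl (cst true))) (h : Codes ρ v σ) (h' : Codes ρ v τ) :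
    σ = τ := by
  by_contra hne
  have := (h σ).symm.trans (h' σ)
  simp only [decide_true, hne, decide_false] at this
  exact hρ this.symm

/-- The variables of the cells `1, …, S` of the rows `ks`. -/
def rowVars (S : ℕ) (ks : Set Row) : Set (GVar E K) :=
  {x | ∃ j ∈ Set.Icc 1 S, ∃ k ∈ ks, ∃ p, x = .inr (j, k, p)}

section

variable [Finite K]

open scoped Classical in
/-- The template that says that a cell has the content `σ`. -/
noncomputable def isCell (i : Fin 3) (k : Row) (W : Labelling E) (σ : K) : QFFormula (TVar E K) :=
  .conj (.inl (cst false)) fun r => .eq (cell i k W r) (.inl (cst (decide (r = σ))))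

theorem holds_isCell {X : Type*} (ρ : GVar E K → X) (i : Fin 3) (k : Row) (W : Labelling E) (σ : K)
    (j : ℕ) : (isCell i k W σ).Holds (ρ ∘ instVar j) ↔ Codes ρ (row ρ k W (j + i)) σ := by
  simp only [isCell, QFFormula.holds_conj]
  rfl

variable [Finite E]

/-- The templates of the variables of the middle cell in the rows `ks`. -/
noncomputable def rowTemplates (ks : Set Row) : List (TVar E K) :=
  listOf {x | ∃ k ∈ ks, ∃ p, x = .inr (1, k, p)}

theorem holds_exRows {X : Type*} (S : ℕ) (ks : Set Row) (I : List (Instr (GVar E K)))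
    (ρ : GVar E K → X) : Instr.Holds (instances S ((rowTemplates ks).map .ex) ++ I) ρ ↔
      ∃ ρ', Set.EqOn ρ' ρ (rowVars S ks)ᶜ ∧ Instr.Holds I ρ' := by
  rw [instances_exs, Instr.holds_exs]
  have hmem (x : GVar E K) : (x ∈ (List.range S).flatMap fun j =>
      (rowTemplates ks).map (instVar j)) ↔ x ∈ rowVars S ks := by
    simp only [List.mem_flatMap, List.mem_range, List.mem_map, rowTemplates, mem_listOf]
    constructor
    · rintro ⟨j, hj, _, ⟨k, hk, p, rfl⟩, rfl⟩
      exact ⟨j + 1, ⟨by omega, by omega⟩, k, hk, p, rfl⟩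
    · rintro ⟨j, ⟨hj, hjS⟩, k, hk, p, rfl⟩
      obtain ⟨j, rfl⟩ := Nat.exists_eq_add_of_le' hj
      exact ⟨j, by omega, _, ⟨k, hk, p, rfl⟩, rfl⟩
  simp only [hmem]
  rfl

/-- The template that says that the next run is the half of the current run that the labelling `W`
prescribes for some name of the challenge. -/
noncomputable def chooseHalf (c : Bool) (W : Labelling E) (r : K) : QFFormula (TVar E K) :=
  .disj (.inl (cst false)) (.inl (cst true)) fun e =>
    .and (.eq (.inl chal) (.inl (name e))) (.and
      (.eq (cell 1 (source !c) W r) (cell 1 (if W e then mid else source c) W r))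
      (.eq (cell 1 (target !c) W r) (cell 1 (if W e then target c else mid) W r)))

/-- The template that says that the last array of the current run arises from the first by one step
of the automaton. -/
noncomputable def localStep (f : K → K → K → K) (c : Bool) (W : Labelling E) :
    QFFormula (TVar E K) :=
  .disj (.inl (cst false)) (.inl (cst true)) fun p : K × K × K =>
    .and (isCell 0 (source c) W p.1) (.and (isCell 1 (source c) W p.2.1)
      (.and (isCell 2 (source c) W p.2.2) (isCell 1 (target c) W (f p.1 p.2.1 p.2.2))))

/-- A round of the game: the existential player chooses the array in the middle of the run, and the
challenge of the universal player decides with which half they continue. -/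
noncomputable def roundInstrs (S : ℕ) (c : Bool) : List (Instr (GVar E K)) :=
  instances S ((rowTemplates {mid}).map .ex) ++ .all (.inl chal) ::
    (instances S ((rowTemplates {source !c, target !c}).map .ex) ++
      instances S [.assert (.conj (.inl (cst false)) fun p : Labelling E × K =>
        chooseHalf c p.1 p.2)])

/-- The game for a run of length `2 ^ k`. -/
noncomputable def gameInstrs (f : K → K → K → K) (S : ℕ) : ℕ → Bool → List (Instr (GVar E K))
  | 0, c => instances S [.assert (.conj (.inl (cst false)) (localStep f c))]
  | k + 1, c => roundInstrs S c ++ gameInstrs f S k !c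

open scoped Classical in
theorem holds_roundInstrs {X : Type*} (S : ℕ) (c : Bool) (I : List (Instr (GVar E K)))
    (ρ : GVar E K → X) : Instr.Holds (roundInstrs S c ++ I) ρ ↔
      ∃ ρ₁, Set.EqOn ρ₁ ρ (rowVars S {mid})ᶜ ∧ ∀ y, ∃ ρ₂,
        Set.EqOn ρ₂ (Function.update ρ₁ (.inl chal) y) (rowVars S {source !c, target !c})ᶜ ∧
        (∀ j < S, ∀ W r, (chooseHalf c W r).Holds (ρ₂ ∘ instVar j)) ∧ Instr.Holds I ρ₂ := by
  simp only [roundInstrs, List.append_assoc, List.cons_append, holds_exRows, Instr.Holds,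
    holds_instances_assert, QFFormula.holds_conj, Prod.forall]
  convert Iff.rfl

end

variable {X : Type*}

/-- The effect of a round on the game of the labelling `W`, when the array `z` was chosen for the
middle of the run, and the play continues with the second half (`b = true`) or the first half. -/
structure RoundStep (S : ℕ) (ρ : GVar E K → X) (c : Bool) (W : Labelling E) (z : ℕ → K → X)
    (b : Bool) (ρ' : GVar E K → X) : Prop where
  global_eq : ∀ g, g ≠ chal → ρ' (.inl g) = ρ (.inl g)
  row_eq : ∀ j ∉ Set.Icc 1 S, ∀ k, row ρ' k W j = row ρ k W j
  source_eq : ∀ j ∈ Set.Icc 1 S, row ρ' (source !c) W j = if b then z j else row ρ (source c) W j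
  target_eq : ∀ j ∈ Set.Icc 1 S, row ρ' (target !c) W j = if b then row ρ (target c) W j else z j

/-- The current run begins with the array `x`. The cells `0` and `S + 1` of this array are never
changed, so they are stored in both copies. -/
def StartsWith (S : ℕ) (ρ : GVar E K → X) (c : Bool) (W : Labelling E) (x : ℕ → K) : Prop :=
  ∀ c', ∀ j ≤ S + 1, (j ∈ Set.Icc 1 S → c' = c) → Codes ρ (row ρ (source c') W j) (x j)

/-- The current run ends with the array `x`. -/
def EndsWith (S : ℕ) (ρ : GVar E K → X) (c : Bool) (W : Labelling E) (x : ℕ → K) : Prop :=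
  ∀ j ∈ Set.Icc 1 S, Codes ρ (row ρ (target c) W j) (x j)

section

variable {S : ℕ} {ρ ρ' : GVar E K → X} {c : Bool} {W : Labelling E} {z : ℕ → K → X} {b : Bool}

theorem RoundStep.codes_iff (h : RoundStep S ρ c W z b ρ') (v : K → X) (σ : K) :
    Codes ρ' v σ ↔ Codes ρ v σ := by
  simp only [Codes, h.global_eq _ Sum.inl_ne_inr]

theorem RoundStep.startsWith {x x' : ℕ → K} (h : RoundStep S ρ c W z b ρ')
    (hx : StartsWith S ρ c W x) (hz : b = true → ∀ j ∈ Set.Icc 1 S, Codes ρ (z j) (x' j))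
    (hx' : ∀ j ∉ Set.Icc 1 S, x' j = x j) : StartsWith S ρ' (!c) W (if b then x' else x) := by
  intro c' j hj hc'
  rw [h.codes_iff]
  by_cases hjS : j ∈ Set.Icc 1 S
  · rw [hc' hjS, h.source_eq j hjS]
    cases b with
    | false => exact hx c j hj fun _ => rfl
    | true => exact hz rfl j hjS
  · have hxj : (if b then x' else x) j = x j := by
      split_ifs
      · exact hx' j hjS
      · rfl
    rw [h.row_eq j hjS, hxj]
    exact hx c' j hj (absurd · hjS)

theorem RoundStep.endsWith_iff (h : RoundStep S ρ c W z b ρ') (x : ℕ → K) :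
    EndsWith S ρ' (!c) W x ↔
      if b then EndsWith S ρ c W x else ∀ j ∈ Set.Icc 1 S, Codes ρ (z j) (x j) := by
  have hcodes : EndsWith S ρ' (!c) W x ↔
      ∀ j ∈ Set.Icc 1 S, Codes ρ (if b then row ρ (target c) W j else z j) (x j) :=
    forall₂_congr fun j hj => by rw [h.codes_iff, h.target_eq j hj]
  rw [hcodes]
  cases b <;> rfl

theorem holds_chooseHalf [Finite E] (c : Bool) (W : Labelling E) (r : K) (ρ : GVar E K → X)
    (j : ℕ) : (chooseHalf c W r).Holds (ρ ∘ instVar j) ↔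
      (∃ e, ρ (.inl chal) = ρ (.inl (name e)) ∧
      row ρ (source !c) W (j + 1) r = row ρ (if W e then mid else source c) W (j + 1) r ∧
      row ρ (target !c) W (j + 1) r = row ρ (if W e then target c else mid) W (j + 1) r) ∨
        ρ (.inl (cst false)) = ρ (.inl (cst true)) := by
  rw [chooseHalf, QFFormula.holds_disj]
  rfl

theorem holds_localStep [Finite K] (f : K → K → K → K) (c : Bool) (W : Labelling E)
    (ρ : GVar E K → X) (j : ℕ) : (localStep f c W).Holds (ρ ∘ instVar j) ↔ (∃ σ τ υ,
      Codes ρ (row ρ (source c) W j) σ ∧ Codes ρ (row ρ (source c) W (j + 1)) τ ∧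
        Codes ρ (row ρ (source c) W (j + 2)) υ ∧
          Codes ρ (row ρ (target c) W (j + 1)) (f σ τ υ)) ∨
            ρ (.inl (cst false)) = ρ (.inl (cst true)) := by
  simp only [localStep, QFFormula.holds_disj, QFFormula.Holds, holds_isCell, Prod.exists]
  rfl

theorem inl_eq_of_eqOn {ks : Set Row} (h : Set.EqOn ρ' ρ (rowVars S ks)ᶜ) (g : Global E) :
    ρ' (.inl g) = ρ (.inl g) :=
  h (by rintro ⟨j, _, k, _, p, hp⟩; cases hp)

theorem row_eq_of_eqOn {ks : Set Row} (h : Set.EqOn ρ' ρ (rowVars S ks)ᶜ) {k : Row} {j : ℕ}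
    (hkj : j ∈ Set.Icc 1 S → k ∉ ks) : row ρ' k W j = row ρ k W j :=
  funext fun r => h (by rintro ⟨j, hj, k, hk, p, hp⟩; cases hp; exact hkj hj hk)

theorem exists_eqOn_row_eq (S : ℕ) (ρ : GVar E K → X) (ks : Set Row)
    (v : Row → Labelling E → ℕ → K → X) : ∃ ρ', Set.EqOn ρ' ρ (rowVars S ks)ᶜ ∧
      ∀ k ∈ ks, ∀ j ∈ Set.Icc 1 S, ∀ W, row ρ' k W j = v k W j := by
  classical
  refine ⟨(rowVars S ks).piecewise
    (Sum.elim (ρ ∘ .inl) fun p => v p.2.1 p.2.2.1 p.1 p.2.2.2) ρ,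
    Set.piecewise_eqOn_compl .., fun k hk j hj W => funext fun r => ?_⟩
  exact Set.piecewise_eq_of_mem _ _ _ ⟨j, hj, k, hk, _, rfl⟩

theorem row_update_global [DecidableEq (GVar E K)] (ρ : GVar E K → X) (g : Global E) (y : X)
    (k : Row) (W : Labelling E) (j : ℕ) : row (Function.update ρ (.inl g) y) k W j = row ρ k W j :=
  funext fun _ => Function.update_of_ne Sum.inr_ne_inl _ _

theorem eqOn_round [DecidableEq (GVar E K)] {ρ₁ ρ₂ : GVar E K → X} {y : X}
    (h₁ : Set.EqOn ρ₁ ρ (rowVars S {mid})ᶜ)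
    (h₂ : Set.EqOn ρ₂ (Function.update ρ₁ (.inl chal) y) (rowVars S {source !c, target !c})ᶜ) :
    ρ₂ (.inl chal) = y ∧ (∀ g, g ≠ chal → ρ₂ (.inl g) = ρ (.inl g)) ∧
      (∀ k W j, (j ∈ Set.Icc 1 S → k ≠ source (!c) ∧ k ≠ target !c) → row ρ₂ k W j = row ρ₁ k W j) ∧
      ∀ k W j, (j ∈ Set.Icc 1 S → k ≠ mid) → row ρ₁ k W j = row ρ k W j := by
  refine ⟨?_, fun g hg => ?_, fun k W j hk => ?_, fun k W j hk => row_eq_of_eqOn h₁ hk⟩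
  · rw [inl_eq_of_eqOn h₂, Function.update_self]
  · rw [inl_eq_of_eqOn h₂, Function.update_of_ne (Sum.inl_injective.ne hg), inl_eq_of_eqOn h₁]
  · rw [row_eq_of_eqOn h₂ (by simpa using hk), row_update_global]

variable [Finite E] [Finite K]

theorem holds_roundInstrs_of_forall (z : Labelling E → ℕ → K → X) {I : List (Instr (GVar E K))}
    (h : ∀ y, ∃ e, ρ (.inl (name e)) = y ∧
      ∀ ρ', (∀ W, RoundStep S ρ c W (z W) (W e) ρ') → Instr.Holds I ρ') :
    Instr.Holds (roundInstrs S c ++ I) ρ := by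
  classical
  rw [holds_roundInstrs]
  obtain ⟨ρ₁, hρ₁, hmid⟩ := exists_eqOn_row_eq S ρ {mid} fun _ => z
  refine ⟨ρ₁, hρ₁, fun y => ?_⟩
  obtain ⟨e, he, hI⟩ := h y
  obtain ⟨ρ₂, hρ₂, hnext⟩ := exists_eqOn_row_eq S (Function.update ρ₁ (.inl chal) y)
    {source !c, target !c} fun k W j => if k = source !c then
      if W e then z W j else row ρ (source c) W j else if W e then row ρ (target c) W j else z W j
  obtain ⟨hchal, hglobal, hrow₂, hrow₁⟩ := eqOn_round hρ₁ hρ₂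
  have hstep (W : Labelling E) : RoundStep S ρ c W (z W) (W e) ρ₂ :=
    { global_eq := hglobal
      row_eq := fun j hj k => (hrow₂ k W j (absurd · hj)).trans (hrow₁ k W j (absurd · hj))
      source_eq := fun j hj => by rw [hnext _ (by simp) j hj, if_pos rfl]
      target_eq := fun j hj => by rw [hnext _ (by simp) j hj, if_neg (by simp)] }
  have hhalf (j : ℕ) (hj : j < S) (W : Labelling E) (r : K) :
      (chooseHalf c W r).Holds (ρ₂ ∘ instVar j) := by
    have hj : j + 1 ∈ Set.Icc 1 S := ⟨by omega, hj⟩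
    refine (holds_chooseHalf ..).2 (.inl ⟨e, ?_, ?_, ?_⟩)
    · rw [hchal, hglobal _ (by simp), he]
    · rw [(hstep W).source_eq _ hj]
      cases W e <;> simp [hrow₂, hrow₁, hmid, hj]
    · rw [(hstep W).target_eq _ hj]
      cases W e <;> simp [hrow₂, hrow₁, hmid, hj]
  exact ⟨ρ₂, hρ₂, hhalf, hI ρ₂ hstep⟩

theorem exists_roundStep_of_holds (hρ : ρ (.inl (cst false)) ≠ ρ (.inl (cst true)))
    {I : List (Instr (GVar E K))} (h : Instr.Holds (roundInstrs S c ++ I) ρ)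
    (hW : ∀ e b, ρ (.inl (name e)) = ρ (.inl (cst b)) → W e = b) :
    ∃ z, ∀ b, ∃ ρ', RoundStep S ρ c W z b ρ' ∧ Instr.Holds I ρ' := by
  classical
  obtain ⟨ρ₁, hρ₁, h⟩ := (holds_roundInstrs ..).1 h
  refine ⟨row ρ₁ mid W, fun b => ?_⟩
  obtain ⟨ρ₂, hρ₂, hhalf, hI⟩ := h (ρ (.inl (cst b)))
  obtain ⟨hchal, hglobal, hrow₂, hrow₁⟩ := eqOn_round hρ₁ hρ₂
  have hchoice (j : ℕ) (hj : j ∈ Set.Icc 1 S) (r : K) :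
      row ρ₂ (source !c) W j r = row ρ₂ (if b then mid else source c) W j r ∧
        row ρ₂ (target !c) W j r = row ρ₂ (if b then target c else mid) W j r := by
    obtain ⟨j, rfl⟩ := Nat.exists_eq_add_of_le' hj.1
    rcases (holds_chooseHalf ..).1 (hhalf j hj.2 W r) with ⟨e, he, heq⟩ | heq
    · rw [hchal, hglobal _ (by simp)] at he
      rwa [hW e b he.symm] at heq
    · rw [hglobal _ (by simp), hglobal _ (by simp)] at heq
      exact absurd heq hρ
  refine ⟨ρ₂, ⟨hglobal, fun j hj k => (hrow₂ k W j (absurd · hj)).trans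
    (hrow₁ k W j (absurd · hj)), fun j hj => ?_, fun j hj => ?_⟩, hI⟩
  · rw [funext fun r => (hchoice j hj r).1]
    cases b <;> simp [hrow₂, hrow₁]
  · rw [funext fun r => (hchoice j hj r).2]
    cases b <;> simp [hrow₂, hrow₁]

end

section

variable [Finite E] [Finite K] {f : K → K → K → K} {S k : ℕ} {c : Bool}
  {ρ : GVar E K → X}

open scoped Classical in
theorem holds_gameInstrs (hnames : ∀ y, ∃ e, ρ (.inl (name e)) = y) {x : Labelling E → ℕ → K}
    (hsource : ∀ W, StartsWith S ρ c W (x W))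
    (htarget : ∀ W, EndsWith S ρ c W ((automaton f S)^[2 ^ k] (x W))) :
    Instr.Holds (gameInstrs f S k c) ρ := by
  induction k generalizing ρ c x with
  | zero =>
    rw [gameInstrs, ← List.append_nil (instances _ _), holds_instances_assert]
    refine ⟨fun j hj => (QFFormula.holds_conj ..).2 fun W => (holds_localStep ..).2 (.inl
      ⟨x W j, x W (j + 1), x W (j + 2), ?_, ?_, ?_, ?_⟩), trivial⟩
    · exact hsource W c j (by omega) fun _ => rfl
    · exact hsource W c (j + 1) (by omega) fun _ => rfl
    · exact hsource W c (j + 2) (by omega) fun _ => rfl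
    · have := htarget W (j + 1) ⟨by omega, hj⟩
      rwa [pow_zero, Function.iterate_one, automaton, if_pos ⟨by omega, hj⟩] at this
  | succ k ih =>
    let half (W : Labelling E) : ℕ → K := (automaton f S)^[2 ^ k] (x W)
    refine holds_roundInstrs_of_forall
      (fun W j r => ρ (.inl (cst (decide (r = half W j))))) fun y => ?_
    obtain ⟨e, he⟩ := hnames y
    refine ⟨e, he, fun ρ' hstep => ih (x := fun W => if W e then half W else x W) ?_ ?_ ?_⟩
    · simpa only [(hstep fun _ => true).global_eq _ (Sum.inr_injective.ne (Option.some_ne_none _))]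
        using hnames
    · exact fun W => (hstep W).startsWith (hsource W) (fun _ _ _ _ => rfl) fun j hj =>
        iterate_automaton_of_notMem f _ _ hj
    · intro W
      rw [(hstep W).endsWith_iff]
      cases hWe : W e with
      | false => exact fun _ _ _ => rfl
      | true =>
        have := htarget W
        rwa [pow_succ, mul_two, Function.iterate_add_apply] at this

theorem endsWith_of_holds_gameInstrs {W : Labelling E} {x : ℕ → K}
    (hρ : ρ (.inl (cst false)) ≠ ρ (.inl (cst true)))
    (hW : ∀ e b, ρ (.inl (name e)) = ρ (.inl (cst b)) → W e = b)
    (h : Instr.Holds (gameInstrs f S k c) ρ) (hsource : StartsWith S ρ c W x) :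
    EndsWith S ρ c W ((automaton f S)^[2 ^ k] x) := by
  induction k generalizing ρ c x with
  | zero =>
    rw [gameInstrs, ← List.append_nil (instances _ _), holds_instances_assert] at h
    rintro j ⟨hj, hjS⟩
    obtain ⟨j, rfl⟩ := Nat.exists_eq_add_of_le' hj
    obtain ⟨σ, τ, υ, hσ, hτ, hυ, hf⟩ := ((holds_localStep ..).1
      ((QFFormula.holds_conj ..).1 (h.1 j hjS) W)).resolve_right hρ
    rw [pow_zero, Function.iterate_one, automaton, if_pos ⟨hj, hjS⟩]
    have huniq {i : ℕ} (hi : i ≤ S + 1) {σ : K} (hσ : Codes ρ (row ρ (source c) W i) σ) : x i = σ :=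
      Codes.unique hρ (hsource c i hi fun _ => rfl) hσ
    rwa [Nat.add_sub_cancel, huniq (by omega) hσ, huniq (by omega) hτ, huniq (by omega) hυ]
  | succ k ih =>
    obtain ⟨z, hz⟩ := exists_roundStep_of_holds hρ h hW
    let half := (automaton f S)^[2 ^ k] x
    have hnext (b : Bool) (hhalf : b = true → ∀ j ∈ Set.Icc 1 S, Codes ρ (z j) (half j)) :
        if b then EndsWith S ρ c W ((automaton f S)^[2 ^ k] half)
          else ∀ j ∈ Set.Icc 1 S, Codes ρ (z j) (half j) := by
      obtain ⟨ρ', hstep, h'⟩ := hz b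
      have := (hstep.endsWith_iff _).1 (ih
        (by simpa only [hstep.global_eq _ Sum.inl_ne_inr] using hρ)
        (fun e b he => hW e b (by
          rwa [hstep.global_eq _ (by simp), hstep.global_eq _ (by simp)] at he)) h'
        (hstep.startsWith hsource hhalf fun j hj => iterate_automaton_of_notMem f _ _ hj))
      cases b <;> exact this
    rw [pow_succ, mul_two, Function.iterate_add_apply]
    exact hnext true fun _ => hnext false nofun

end

end HalvingGame

/-! ### The sentence of the game -/

namespace Scheme

variable {G F α ι : Type} [DecidableEq ι] (S : ℕ) (w : List α) (v : ι → ℕ)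

theorem instrs_append (P Q : Scheme α ι (Instr (G ⊕ Fin 3 × F))) :
    (append P Q).instrs S w v = P.instrs S w v ++ Q.instrs S w v :=
  List.map_append

theorem instrs_loop (x : ι) (P : Scheme α ι (Instr (G ⊕ Fin 3 × F))) : (loop x P).instrs S w v =
    (List.range S).flatMap fun j => P.instrs S w (Function.update v x j) :=
  List.map_flatMap

theorem instrs_tokens (x : ι) (l : List (Instr (G ⊕ Fin 3 × F))) :
    (tokens x l).instrs S w v = l.map (Instr.map (instVar (v x))) :=
  List.map_map

theorem instrs_loop_tokens (x : ι) (l : List (Instr (G ⊕ Fin 3 × F))) :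
    (loop x (tokens x l)).instrs S w v = instances S l := by
  simp only [instrs_loop, instrs_tokens, Function.update_self, instances]

end Scheme

section GameSentence

open Global Row

variable {α E K : Type}

/-- The variables of the halving game on the cells `0, …, S + 1`. -/
def gameVars (S : ℕ) : Set (GVar E K) :=
  {x | ∀ j p, x = .inr (j, p) → j ≤ S + 1}

theorem inl_mem_gameVars {S : ℕ} (g : Global E) : (.inl g : GVar E K) ∈ gameVars S :=
  nofun

theorem instVar_mem_gameVars {S j : ℕ} (hj : j < S) (x : TVar E K) :
    instVar j x ∈ gameVars S := by
  rcases x with g | ⟨i, p⟩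
  · exact inl_mem_gameVars g
  · rintro _ _ ⟨⟩
    have := i.2
    change j + (i : ℕ) ≤ S + 1
    omega

section

variable [Finite E] [Finite K]

/-- The scheme of a round of the halving game. -/
noncomputable def roundScheme (c : Bool) : Scheme α (Fin 2) (Instr (TVar E K)) :=
  .append (.loop 0 (.tokens 0 ((rowTemplates {mid}).map .ex)))
    (.append (.tokens 0 [.all (.inl chal)])
      (.append (.loop 0 (.tokens 0 ((rowTemplates {source !c, target !c}).map .ex)))
        (.loop 0 (.tokens 0 [.assert (.conj (.inl (cst false)) fun p : Labelling E × K =>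
          chooseHalf c p.1 p.2)]))))

theorem instrs_roundScheme (S : ℕ) (w : List α) (c : Bool) (v : Fin 2 → ℕ) :
    (roundScheme (E := E) (K := K) c).instrs S w v = roundInstrs S c := by
  simp only [roundScheme, Scheme.instrs_append, Scheme.instrs_loop_tokens, Scheme.instrs_tokens]
  rfl

/-- The scheme of the halving game for runs of length `2 ^ (2 * S)`, where `S` is the bound of the
scheme. -/
noncomputable def gameScheme (f : K → K → K → K) : Scheme α (Fin 2) (Instr (TVar E K)) :=
  .append (.loop 1 (.append (roundScheme false) (roundScheme true)))
    (.loop 0 (.tokens 0 [.assert (.conj (.inl (cst false)) (localStep f false))]))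

theorem instrs_gameScheme (f : K → K → K → K) (S : ℕ) (w : List α) (v : Fin 2 → ℕ) :
    (gameScheme (E := E) f).instrs S w v = gameInstrs f S (2 * S) false := by
  have hrounds (l : List ℕ) : (l.flatMap fun _ => roundInstrs S false ++ roundInstrs S true) ++
      gameInstrs f S 0 false = gameInstrs (E := E) f S (2 * l.length) false := by
    induction l with
    | nil => rfl
    | cons j l ih =>
      rw [List.flatMap_cons, List.append_assoc, ih, List.append_assoc]
      rfl
  have := hrounds (List.range S)
  rw [List.length_range] at this
  simp only [gameScheme, Scheme.instrs_append, Scheme.instrs_loop, instrs_roundScheme]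
  exact this

/-- The template variables that are bound existentially at the beginning of the sentence. -/
noncomputable def boundTemplates : List (TVar E K) :=
  listOf {x | ∀ t, x ≠ .inl (cst t)}

/-- The scheme of the beginning of the sentence. The values of the variables for the truth values
are chosen by the universal player, who loses if they are equal. -/
noncomputable def openingScheme : Scheme α (Fin 2) (Instr (TVar E K)) :=
  .append (.tokens 0 [.all (.inl (cst false)), .all (.inl (cst true)),
    .alt (.eq (.inl (cst false)) (.inl (cst true)))]) (.loop 0 (.tokens 0 (boundTemplates.map .ex)))

/-- The variables that are bound existentially at the beginning of the sentence. -/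
noncomputable def boundVars (S : ℕ) : List (GVar E K) :=
  (List.range S).flatMap fun j => boundTemplates.map (instVar j)

theorem instrs_openingScheme (S : ℕ) (w : List α) (v : Fin 2 → ℕ) :
    (openingScheme (E := E) (K := K)).instrs S w v =
      Instr.opening (.inl (cst false)) (.inl (cst true)) (boundVars S) := by
  simp only [openingScheme, Scheme.instrs_append, Scheme.instrs_loop_tokens, Scheme.instrs_tokens,
    instances_exs]
  rfl

theorem mem_boundVars {S : ℕ} (hS : 0 < S) {x : GVar E K} :
    x ∈ boundVars S ↔ x ∈ gameVars S ∧ ∀ t, x ≠ .inl (cst t) := by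
  simp only [boundVars, List.mem_flatMap, List.mem_range, List.mem_map, boundTemplates, mem_listOf,
    gameVars, Set.mem_ofPred_eq]
  constructor
  · rintro ⟨j, hj, x, hx, rfl⟩
    refine ⟨instVar_mem_gameVars hj x, fun t h => ?_⟩
    rcases x with g | p
    · exact hx t (congrArg Sum.inl (Sum.inl_injective h))
    · exact Sum.inr_ne_inl h
  · rcases x with g | ⟨j, p⟩
    · rintro ⟨-, hg⟩
      exact ⟨0, hS, .inl g, fun t h => hg t (congrArg Sum.inl (Sum.inl_injective h)), rfl⟩
    · rintro ⟨hj, -⟩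
      have hj := hj j p rfl
      have hi : j - min j (S - 1) < 3 := by omega
      refine ⟨min j (S - 1), by omega, .inr (⟨j - min j (S - 1), hi⟩, p), nofun, ?_⟩
      have hadd : min j (S - 1) + (j - min j (S - 1)) = j := by omega
      simp only [instVar, Sum.map_inr, Prod.map, id, hadd]

variable {x : Fin 3 → InSym α → K}

/-- The scheme that fixes the initial contents of the cell with the offset `i`. -/
noncomputable def initialCell (x : Fin 3 → InSym α → K) (i : Fin 3) :
    Scheme α (Fin 2) (Instr (TVar E K)) :=
  .read 0 i fun a => .tokens 0 [.assert (.conj (.inl (cst false)) fun p : Labelling E × Bool =>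
    isCell i (source p.2) p.1 (x i a))]

/-- The scheme that fixes the array at the beginning of the run. -/
noncomputable def initialScheme (x : Fin 3 → InSym α → K) : Scheme α (Fin 2) (Instr (TVar E K)) :=
  .append (initialCell x 0) (.append (initialCell x 1) (.loop 0 (initialCell x 2)))

/-- The initial array of an automaton that runs on an input word. The function `x 0` is used for the
cell `0`, the function `x 1` for the cell `1`, and the function `x 2` for all others. -/
def initialArray (x : Fin 3 → InSym α → K) (w : List α) : ℕ → K
  | 0 => x 0 (Transducer.readInput w 0)
  | 1 => x 1 (Transducer.readInput w 1)
  | j + 2 => x 2 (Transducer.readInput w (j + 2))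

theorem holds_initialCell {X : Type*} {S : ℕ} {w : List α} {v : Fin 2 → ℕ} {i : Fin 3}
    (I : List (Instr (GVar E K))) (ρ : GVar E K → X) :
    Instr.Holds ((initialCell x i).instrs S w v ++ I) ρ ↔
      (∀ W c, Codes ρ (row ρ (source c) W (v 0 + i)) (x i (Transducer.readInput w (i + v 0)))) ∧
        Instr.Holds I ρ := by
  refine and_congr_left' ((QFFormula.holds_map ..).trans ?_)
  simp only [QFFormula.holds_conj, holds_isCell, Prod.forall]

theorem holds_initialScheme {X : Type*} {S : ℕ} {w : List α}
    (I : List (Instr (GVar E K))) (ρ : GVar E K → X) :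
    Instr.Holds ((initialScheme x).instrs S w 0 ++ I) ρ ↔
      (∀ W c, StartsWith S ρ c W (initialArray x w)) ∧ Instr.Holds I ρ := by
  simp only [initialScheme, Scheme.instrs_append, Scheme.instrs_loop, List.append_assoc,
    holds_initialCell, Instr.holds_flatMap fun _ I => holds_initialCell I ρ]
  simp only [← and_assoc]
  refine and_congr_left' ⟨fun ⟨⟨h₀, h₁⟩, h₂⟩ W _ c j hj _ => ?_,
    fun h => ⟨⟨fun W c => ?_, fun W c => ?_⟩, fun j hj W c => ?_⟩⟩
  · match j with
    | 0 => exact h₀ W c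
    | 1 => exact h₁ W c
    | j + 2 => simpa [add_comm, initialArray] using h₂ j (List.mem_range.2 (by omega)) W c
  · exact h W c c 0 (Nat.zero_le _) fun _ => rfl
  · exact h W c c 1 (Nat.le_add_left _ _) fun _ => rfl
  · have := List.mem_range.1 hj
    simpa [add_comm, initialArray] using h W c c (j + 2) (by omega) fun _ => rfl

/-- The scheme that says that the last array of the run has contents in `ok`. -/
noncomputable def acceptScheme (ok : Set K) : Scheme α (Fin 2) (Instr (TVar E K)) :=
  .loop 0 (.tokens 0 [.assert (.conj (.inl (cst false)) fun W : Labelling E =>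
    .disj (.inl (cst false)) (.inl (cst true)) fun σ : ok => isCell 1 (target false) W σ)])

theorem holds_acceptScheme {X : Type*} {S : ℕ} {w : List α} {v : Fin 2 → ℕ} (ok : Set K)
    (I : List (Instr (GVar E K))) (ρ : GVar E K → X) :
    Instr.Holds ((acceptScheme ok).instrs S w v ++ I) ρ ↔
      (∀ j ∈ Set.Icc 1 S, ∀ W, (∃ σ ∈ ok, Codes ρ (row ρ (target false) W j) σ) ∨
        ρ (.inl (cst false)) = ρ (.inl (cst true))) ∧ Instr.Holds I ρ := by
  rw [acceptScheme, Scheme.instrs_loop_tokens, holds_instances_assert]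
  simp only [QFFormula.holds_conj, QFFormula.holds_disj, holds_isCell, Subtype.exists, exists_prop]
  refine and_congr_left' ⟨fun h j hj => ?_, fun h j hj => h (j + 1) ⟨by omega, hj⟩⟩
  obtain ⟨j, rfl⟩ := Nat.exists_eq_add_of_le' hj.1
  exact h j hj.2

/-- The scheme of the part of the sentence after the beginning. -/
noncomputable def bodyScheme (f : K → K → K → K) (x : Fin 3 → InSym α → K) (ok : Set K) :
    Scheme α (Fin 2) (Instr (TVar E K)) :=
  .append (initialScheme x) (.append (acceptScheme ok) (gameScheme f))

/-- The scheme of the whole sentence. -/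
noncomputable def sentenceScheme (f : K → K → K → K) (x : Fin 3 → InSym α → K) (ok : Set K) :
    Scheme α (Fin 2) (Instr (TVar E K)) :=
  .append openingScheme (bodyScheme f x ok)

variable {f : K → K → K → K} {ok : Set K} {S : ℕ} {w : List α}

theorem scoped_sentenceScheme : (sentenceScheme (E := E) f x ok).Scoped ∅ := by
  simp [sentenceScheme, openingScheme, bodyScheme, initialScheme, initialCell, acceptScheme,
    gameScheme, roundScheme, Scheme.Scoped]

theorem instrs_sentenceScheme : (sentenceScheme (E := E) f x ok).instrs S w 0 =
    Instr.opening (.inl (cst false)) (.inl (cst true)) (boundVars S) ++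
      (bodyScheme f x ok).instrs S w 0 := by
  rw [sentenceScheme, Scheme.instrs_append, instrs_openingScheme]

theorem holds_sentenceScheme {X : Type*} (hS : 0 < S) {ρ : GVar E K → X} :
    Instr.Holds ((sentenceScheme f x ok).instrs S w 0) ρ ↔ ∀ a b, a = b ∨ ∃ ρ' : GVar E K → X,
      ρ' (.inl (cst false)) = a ∧ ρ' (.inl (cst true)) = b ∧ Set.EqOn ρ' ρ (gameVars S)ᶜ ∧
      (∀ W c, StartsWith S ρ' c W (initialArray x w)) ∧
      (∀ j ∈ Set.Icc 1 S, ∀ W, (∃ σ ∈ ok, Codes ρ' (row ρ' (target false) W j) σ) ∨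
        ρ' (.inl (cst false)) = ρ' (.inl (cst true))) ∧
      Instr.Holds (gameInstrs f S (2 * S) false) ρ' := by
  rw [instrs_sentenceScheme, Instr.holds_opening (by simp) (by simp [mem_boundVars hS])
    (by simp [mem_boundVars hS])]
  simp only [bodyScheme, Scheme.instrs_append, holds_initialScheme, holds_acceptScheme,
    instrs_gameScheme, mem_boundVars hS]
  have heqOn (ρ' : GVar E K → X) : (∀ z, ¬(z ∈ gameVars S ∧ ∀ t, z ≠ .inl (cst t)) →
      z ≠ .inl (cst false) → z ≠ .inl (cst true) → ρ' z = ρ z) ↔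
        Set.EqOn ρ' ρ (gameVars S)ᶜ := by
    constructor
    · exact fun h z hz => h z (fun hz' => hz hz'.1) (fun hzc => hz (hzc ▸ inl_mem_gameVars _))
        fun hzc => hz (hzc ▸ inl_mem_gameVars _)
    · exact fun h z hz h₀ h₁ => h fun hz' => hz ⟨hz', Bool.forall_bool.2 ⟨h₀, h₁⟩⟩
  simp only [heqOn]

/-- The sentence with names for the elements of `E` that says that the automaton with the local rule
`f`, when it starts from the initial array, is after `2 ^ (2 * S)` steps in an array with contents
in `ok`. -/
noncomputable def gameSentence (f : K → K → K → K) (x : Fin 3 → InSym α → K) (ok : Set K) (S : ℕ)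
    (w : List α) : Formula eqLang :=
  Instr.toFormula varNum (.inl (cst false)) ((sentenceScheme (E := E) f x ok).instrs S w 0)

theorem isSentence_gameSentence (hS : 0 < S) : (gameSentence (E := E) f x ok S w).IsSentence := by
  rw [gameSentence, instrs_sentenceScheme]
  refine Instr.isSentence_toFormula_opening _ _ _ fun i hi => ?_
  obtain ⟨p, hp, rfl⟩ := List.mem_map.1 hi
  have hpS : p.1 < S := Scheme.lt_of_mem_eval (fun _ => hS) hp
  rw [Instr.vars_map]
  rintro _ ⟨y, -, rfl⟩
  rw [Set.mem_union, Set.mem_ofPred_eq, mem_boundVars hS]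
  exact (em (∃ t, instVar p.1 y = .inl (cst t))).imp (fun ⟨t, h⟩ => by cases t <;> simp [h])
    fun h => ⟨instVar_mem_gameVars hpS y, not_exists.1 h⟩

open scoped Classical in
/-- The values of the variables that are chosen by the existential player at the beginning, for the
truth values `a` and `b` and the run that begins with `y` and ends with `z`. -/
noncomputable def runValuation {X : Type*} (a b : X) (nm : E → X) (y z : ℕ → K) : GVar E K → X
  | .inl (.inl t) => bif t then b else a
  | .inl (.inr e) => e.elim a nm
  | .inr (j, k, _, r) => if r = (if k = target false then z else y) j then b else a

theorem trueIn_gameSentence {X : Type*} (hS : 0 < S) {nm : E → X}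
    (hnm : Function.Surjective nm)
    (h : ∀ j ∈ Set.Icc 1 S, (automaton f S)^[2 ^ (2 * S)] (initialArray x w) j ∈ ok) :
    (gameSentence (E := E) f x ok S w).TrueIn X := by
  classical
  intro ε
  refine (Instr.holds_toFormula varNum_injective ..).2 ((holds_sentenceScheme hS).2 fun a b => ?_)
  refine or_iff_not_imp_left.2 fun _ => ?_
  let y := initialArray x w
  let z := (automaton f S)^[2 ^ (2 * S)] y
  let ρ' := (gameVars S).piecewise (runValuation a b nm y z) (ε ∘ varNum)
  have hin {v : GVar E K} (hv : v ∈ gameVars S) : ρ' v = runValuation a b nm y z v :=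
    Set.piecewise_eq_of_mem _ _ _ hv
  have hrow (k : Row) (W : Labelling E) {j : ℕ} (hj : j ≤ S + 1) :
      Codes ρ' (row ρ' k W j) ((if k = target false then z else y) j) := by
    intro r
    rw [row, hin (by rintro _ _ ⟨⟩; exact hj), hin (inl_mem_gameVars _)]
    simp [runValuation]
  have hsource (W : Labelling E) (c : Bool) : StartsWith S ρ' c W y := fun c' j hj _ => by
    simpa using hrow (source c') W hj
  have htarget (W : Labelling E) : EndsWith S ρ' false W z := fun j hj => by
    simpa using hrow (target false) W (hj.2.trans (Nat.le_succ S))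
  exact ⟨ρ', hin (inl_mem_gameVars _), hin (inl_mem_gameVars _), Set.piecewise_eqOn_compl _ _ _,
    hsource, fun j hj W => .inl ⟨z j, h j hj, htarget W j hj⟩,
    holds_gameInstrs (fun v => (hnm v).imp fun e he => (hin (inl_mem_gameVars _)).trans he)
      (fun W => hsource W false) htarget⟩

theorem iterate_mem_of_trueIn_gameSentence {X : Type*} [Nontrivial X] (hS : 0 < S)
    (h : (gameSentence (E := E) f x ok S w).TrueIn X) :
    ∀ j ∈ Set.Icc 1 S, (automaton f S)^[2 ^ (2 * S)] (initialArray x w) j ∈ ok := by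
  classical
  obtain ⟨a, b, hab⟩ := exists_pair_ne X
  obtain ⟨ρ', rfl, rfl, -, hsource, hok, hgame⟩ :=
    ((holds_sentenceScheme hS).1 ((Instr.holds_toFormula varNum_injective ..).1 (h fun _ => a))
      a b).resolve_left hab
  let W : Labelling E := fun e => decide (ρ' (.inl (name e)) = ρ' (.inl (cst true)))
  have hW (e : E) (t : Bool) (he : ρ' (.inl (name e)) = ρ' (.inl (cst t))) : W e = t := by
    cases t
    · exact decide_eq_false (he ▸ hab)
    · exact decide_eq_true he
  have htarget := endsWith_of_holds_gameInstrs hab hW hgame (hsource W false)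
  intro j hj
  obtain ⟨σ, hσ, hcodes⟩ := (hok j hj W).resolve_right hab
  exact (htarget j hj).unique hab hcodes ▸ hσ

end

end GameSentence

/-! ### Hardness -/

theorem exists_mul_eval_le_pow (p : Polynomial ℕ) (k : ℕ) :
    ∃ C, ∀ m, k * p.eval m ≤ (m + 1 + C) ^ (C + 1) := by
  obtain ⟨c, d, h⟩ : ∃ c d, ∀ m, p.eval m ≤ c * (m + 1) ^ d := by
    refine ⟨p.sum fun _ a => a, p.natDegree, fun m => ?_⟩
    rw [Polynomial.eval_eq_sum, Polynomial.sum, Polynomial.sum, Finset.sum_mul]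
    refine Finset.sum_le_sum fun i hi => Nat.mul_le_mul_left _ ?_
    exact (Nat.pow_le_pow_left (Nat.le_succ m) i).trans
      (Nat.pow_le_pow_right (Nat.succ_pos m) (Polynomial.le_natDegree_of_mem_supp i hi))
  refine ⟨k * c + d, fun m => ?_⟩
  calc k * p.eval m ≤ k * (c * (m + 1) ^ d) := Nat.mul_le_mul_left _ (h m)
    _ = k * c * (m + 1) ^ d := (mul_assoc ..).symm
    _ ≤ (m + 1 + (k * c + d)) * (m + 1 + (k * c + d)) ^ (k * c + d) :=
      Nat.mul_le_mul (by omega) ((Nat.pow_le_pow_left (by omega) d).trans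
        (Nat.pow_le_pow_right (by omega) (by omega)))
    _ = (m + 1 + (k * c + d)) ^ (k * c + d + 1) := (pow_succ' ..).symm

namespace TM

variable {α : Type} (M : TM α)

/-- The tape symbol for a symbol of a read-only input tape. -/
def tapeSymbol : InSym α → M.Γ
  | .letter a => M.inp a
  | _ => M.blank

theorem tape_init (w : List α) (j : ℕ) :
    (M.init w).tape j = M.tapeSymbol (Transducer.readInput w (j + 1)) := by
  simp only [TM.init, Transducer.readInput]
  cases w[j]? <;> rfl

/-- The contents of the cells of the initial configuration: the border, the cell with the head, and
the other cells. -/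
def initialContent : Fin 3 → InSym α → M.Cell
  | 0, _ => none
  | 1, a => some (M.tapeSymbol a, some M.start)
  | 2, a => some (M.tapeSymbol a, none)

theorem cells_init (w : List α) : M.cells (M.init w) = initialArray M.initialContent w := by
  funext j
  match j with
  | 0 => rfl
  | 1 => exact congrArg some (Prod.ext (M.tape_init w 0) (by simp [content, init]))
  | j + 2 => exact congrArg some (Prod.ext (M.tape_init w (j + 1)) (by simp [content, init]))

end TM

theorem pspaceHard_pmc_eqLang {A B : Type*} [Finite A] [Nontrivial B] :
    (PMC eqLang A B).PSPACEHard := by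
  rintro α _ L ⟨M, p, hL, hp⟩
  have := M.finQ
  have := M.finΓ
  let k := Nat.card (M.Γ × Option M.Q)
  obtain ⟨C, hC⟩ := exists_mul_eval_le_pow p k
  let S (w : List α) : ℕ := (w.length + 1 + C) ^ (C + 1)
  have hS (w : List α) : 0 < S w := by positivity
  have hk : 0 < k := Nat.card_pos_iff.2 ⟨⟨M.blank, none⟩, inferInstance⟩
  have hmem (w : List α) := M.mem_iff_iterate_automaton_mem hL hp (w := w) (S := S w)
    (N := 2 ^ (2 * S w)) ((Nat.le_mul_of_pos_left _ hk).trans (hC _)) <| calc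
      k ^ p.eval w.length
      _ ≤ (2 ^ k) ^ p.eval w.length := Nat.pow_le_pow_left Nat.lt_two_pow_self.le _
      _ = 2 ^ (k * p.eval w.length) := (pow_mul ..).symm
      _ ≤ 2 ^ (2 * S w) :=
        Nat.pow_le_pow_right two_pos ((hC _).trans (Nat.le_mul_of_pos_left _ two_pos))
  simp only [M.cells_init] at hmem
  let φ (w : List α) : Formula eqLang := gameSentence (E := Fin (Nat.card A)) M.localRule
    M.initialContent M.nonRejecting (S w) w
  have hφ (w : List α) : (φ w).IsSentence := isSentence_gameSentence (hS w)
  refine ⟨fun w => (φ w).encode, logspaceComputable_encode_toFormula scoped_sentenceScheme C _,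
    fun w => ⟨fun hw => ⟨φ w, hφ w, ?_, rfl⟩, fun hw => ⟨φ w, hφ w, fun h => hw ?_, rfl⟩⟩⟩
  · exact trueIn_gameSentence (hS w) (Finite.equivFin A).symm.surjective ((hmem w).1 hw)
  · exact (hmem w).2 (iterate_mem_of_trueIn_gameSentence (hS w) h)

theorem isTemplate_eqLang {A B : Type*} [Finite A] [Finite B] [Nonempty B]
    (h : Nat.card B ≤ Nat.card A) : IsTemplate eqLang A B := by
  have := Fintype.ofFinite A
  have := Fintype.ofFinite B
  rw [Nat.card_eq_fintype_card, Nat.card_eq_fintype_card] at h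
  obtain ⟨g⟩ := Function.Embedding.nonempty_of_card_le h
  exact fun φ _ => Formula.TrueIn.of_surjective (Function.invFun_surjective g.injective)

end PromiseMC

theorem mainTheorem6 {A B : Type*} [Finite A] [Finite B]
    (hB : 2 ≤ Nat.card B) (hAB : Nat.card B ≤ Nat.card A) :
    PromiseMC.IsTemplate PromiseMC.eqLang A B ∧
      (PromiseMC.PMC PromiseMC.eqLang A B).PSPACEHard := by
  have : Nontrivial B := Finite.one_lt_card_iff_nontrivial.1 hB
  exact ⟨PromiseMC.isTemplate_eqLang hAB, PromiseMC.pspaceHard_pmc_eqLang⟩
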